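/- Let $\mathbb T=\{z\in\mathbb C:|z|=1\}$ with the normalized Lebesgue measure $m$, $m(\mathbb T)=1$, and let $\widehat f(n)=\frac1{2\pi}\int_{-\pi}^{\pi}f(e^{i\theta})e^{-in\theta}\,d\theta$, $n\in\mathbb Z$, be the Fourier coefficients of $f\in L^1$. A Banach function norm is a map $\rho$ from the measurable functions $\mathbb T\to[0,\infty]$ to $[0,\infty]$ such that for all measurable $f,g,f_n:\mathbb T\to[0,\infty]$ and all constants $a\ge0$: $\rho(f)=0$ if and only if $f=0$ a.e.; $\rho(af)=a\rho(f)$; $\rho(f+g)\le\rho(f)+\rho(g)$; $g\le f$ a.e. implies $\rho(g)\le\rho(f)$; $f_n\uparrow f$ a.e. implies $\rho(f_n)\uparrow\rho(f)$; $\rho(1)<\infty$; and $\int_{\mathbb T}f\,dm\le C\rho(f)$ with a constant $C\in(0,\infty)$ independent of $f$. The Banach function space $X$ generated by $\rho$ consists of all measurable $f:\mathbb T\to\mathbb C$ (modulo a.e. equality) with $\|f\|_X:=\rho(|f|)<\infty$, and $H[X]:=\{g\in X:\widehat g(n)=0\text{ for all }n<0\}$, with the norm of $X$. For $f\in L^1$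 let $$(Sf)(t)=\frac1{\pi i}\,\mathrm{p.v.}\!\int_{\mathbb T}\frac{f(\tau)}{\tau-t}\,d\tau,\qquad Pf=\tfrac12(f+Sf)\qquad\text{a.e. on }\mathbb T;$$ $P$ is the Riesz projection. When $P$ is bounded on $X$, the Toeplitz operator with symbol $a$ is $T(a):H[X]\to H[X]$, $T(a)f=P(af)$. The essential norm of a bounded linear operator $A$ on $H[X]$ is $\|A\|_{\mathrm e}=\inf\{\|A-K\|:K\text{ a compact linear operator on }H[X]\}$. Let $\mathbf e_{-1}(z)=z^{-1}$, let $C$ be the space of continuous functions $\mathbb T\to\mathbb C$, $H^\infty=H[L^\infty]$, and $C+H^\infty=\{g+h:g\in C,\ h\in H^\infty\}\subseteq L^\infty$. **Theorem.** Let $X$ be a Banach function space on $\mathbb T$ on which the Riesz projection $P$ is bounded. Then, for every $a\in C+H^\infty$, $T(a)$ is a well-defined bounded linear operator on $H[X]$, and the following statements are equivalent: (i) $\|T(\mathbf e_{-1})\|_{\mathrm e}=1$; (ii) $\|T(a)\|_{\mathrm e}=\|a\|_{L^\infty}$ for every $a\in C+H^\infty$. -/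

import Mathlib

open MeasureTheory Filter Topology
open scoped ENNReal NNReal

noncomputable section

namespace AbstractHardy

instance factTwoPiPos : Fact ((0 : ℝ) < 2 * Real.pi) := ⟨Real.two_pi_pos⟩

/-- The unit circle `𝕋`, parametrised by the angle `θ ∈ ℝ / 2πℤ`. -/
abbrev UnitCirc : Type := AddCircle (2 * Real.pi)

/-- The Lebesgue measure on `𝕋`, normalised so that the circle has measure one. -/
abbrev normMeas : Measure UnitCirc := AddCircle.haarAddCircle

/-- The point `e^{iθ}` of `{z ∈ ℂ : |z| = 1}` with angle `θ`. -/
def point (θ : UnitCirc) : ℂ := (AddCircle.toCircle θ : ℂ)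

/-! ### Banach function spaces -/

/-- A Banach function norm on the nonnegative extended-valued Lebesgue measurable
(that is, almost everywhere measurable) functions on the circle. Its values at other functions
play no role. -/
structure BanachFunctionNorm where
  /-- The underlying functional. -/
  rho : (UnitCirc → ℝ≥0∞) → ℝ≥0∞
  /-- `ρ(f) = 0` if and only if `f = 0` a.e. -/
  eq_zero_iff : ∀ f, AEMeasurable f normMeas → (rho f = 0 ↔ f =ᵐ[normMeas] 0)
  /-- Positive homogeneity. -/
  smul : ∀ (a : ℝ≥0) (f), AEMeasurable f normMeas →
    rho (fun t => (a : ℝ≥0∞) * f t) = (a : ℝ≥0∞) * rho f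
  /-- The triangle inequality. -/
  add_le : ∀ f g, AEMeasurable f normMeas → AEMeasurable g normMeas →
    rho (fun t => f t + g t) ≤ rho f + rho g
  /-- The lattice property. -/
  mono : ∀ f g, AEMeasurable f normMeas → AEMeasurable g normMeas →
    (∀ᵐ t ∂normMeas, g t ≤ f t) → rho g ≤ rho f
  /-- The Fatou property. -/
  fatou : ∀ (F : ℕ → UnitCirc → ℝ≥0∞) (f : UnitCirc → ℝ≥0∞),
    (∀ n, AEMeasurable (F n) normMeas) → AEMeasurable f normMeas →
    (∀ᵐ t ∂normMeas, Monotone (fun n => F n t) ∧ Tendsto (fun n => F n t) atTop (𝓝 (f t))) →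
    Monotone (fun n => rho (F n)) ∧ Tendsto (fun n => rho (F n)) atTop (𝓝 (rho f))
  /-- Constants have finite norm. -/
  one_lt_top : rho (fun _ => 1) < ∞
  /-- The norm dominates the `L¹` norm. -/
  lintegral_le : ∃ C : ℝ≥0, ∀ f, AEMeasurable f normMeas →
    ∫⁻ t, f t ∂normMeas ≤ (C : ℝ≥0∞) * rho f

namespace BanachFunctionNorm

variable (ρ : BanachFunctionNorm)

/-- `ρ(|f|)` for a (class of a) complex-valued measurable function `f`. -/
def eval (f : UnitCirc →ₘ[normMeas] ℂ) : ℝ≥0∞ := ρ.rho (fun t => ‖f t‖ₑ)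

theorem aemeasurable_enorm (f : UnitCirc →ₘ[normMeas] ℂ) :
    AEMeasurable (fun t => ‖f t‖ₑ) normMeas :=
  f.aestronglyMeasurable.enorm

theorem eval_eq_zero_iff (f : UnitCirc →ₘ[normMeas] ℂ) : ρ.eval f = 0 ↔ f = 0 := by
  rw [eval, ρ.eq_zero_iff _ (aemeasurable_enorm f)]
  constructor
  · intro h
    apply AEEqFun.ext
    filter_upwards [h, AEEqFun.coeFn_zero (α := UnitCirc) (β := ℂ) (μ := normMeas)] with t h1 h2
    rw [h2]
    simpa using h1
  · rintro rfl
    filter_upwards [AEEqFun.coeFn_zero (α := UnitCirc) (β := ℂ) (μ := normMeas)] with t h2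
    simp [h2]

theorem eval_add_le (f g : UnitCirc →ₘ[normMeas] ℂ) :
    ρ.eval (f + g) ≤ ρ.eval f + ρ.eval g := by
  refine le_trans (ρ.mono _ _ ((aemeasurable_enorm f).add (aemeasurable_enorm g))
    (aemeasurable_enorm (f + g)) ?_)
    (ρ.add_le _ _ (aemeasurable_enorm f) (aemeasurable_enorm g))
  filter_upwards [AEEqFun.coeFn_add f g] with t h
  rw [h]
  exact enorm_add_le _ _

theorem eval_smul (c : ℂ) (f : UnitCirc →ₘ[normMeas] ℂ) :
    ρ.eval (c • f) = ‖c‖ₑ * ρ.eval f := by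
  have h1 : ρ.eval (c • f) = ρ.rho (fun t => (‖c‖₊ : ℝ≥0∞) * ‖f t‖ₑ) := by
    have hae : ∀ᵐ t ∂normMeas, ‖(c • f) t‖ₑ = (‖c‖₊ : ℝ≥0∞) * ‖f t‖ₑ := by
      filter_upwards [AEEqFun.coeFn_smul c f] with t h
      rw [h, Pi.smul_apply, enorm_smul]
      rfl
    have hm := (aemeasurable_enorm f).const_mul (‖c‖₊ : ℝ≥0∞)
    apply le_antisymm
    · exact ρ.mono _ _ hm (aemeasurable_enorm _) (hae.mono fun t h => h.le)
    · exact ρ.mono _ _ (aemeasurable_enorm _) hm (hae.mono fun t h => h.ge)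
  rw [h1, ρ.smul _ _ (aemeasurable_enorm f)]
  rfl

/-- The Banach function space `X` generated by `ρ`: all (classes of) measurable functions `f`
with `ρ(|f|) < ∞`. -/
def space : Submodule ℂ (UnitCirc →ₘ[normMeas] ℂ) where
  carrier := {f | ρ.eval f < ∞}
  add_mem' := fun {f g} hf hg =>
    lt_of_le_of_lt (ρ.eval_add_le f g) (ENNReal.add_lt_top.2 ⟨hf, hg⟩)
  zero_mem' := by
    change ρ.eval 0 < ∞
    rw [(ρ.eval_eq_zero_iff 0).2 rfl]
    exact ENNReal.zero_lt_top
  smul_mem' := fun c f hf => by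
    change ρ.eval (c • f) < ∞
    rw [eval_smul]
    exact ENNReal.mul_lt_top enorm_lt_top hf

/-- The norm `‖f‖_X = ρ(|f|)`. -/
instance instNormSpace : Norm ρ.space := ⟨fun f => (ρ.eval f).toReal⟩

theorem norm_def (f : ρ.space) : ‖f‖ = (ρ.eval f).toReal := rfl

theorem eval_ne_top (f : ρ.space) : ρ.eval f ≠ ∞ := ne_of_lt f.2

theorem normedSpaceCore : NormedSpace.Core ℂ ρ.space where
  norm_nonneg f := ENNReal.toReal_nonneg
  norm_smul c f := by
    rw [norm_def, norm_def, Submodule.coe_smul, eval_smul, ENNReal.toReal_mul, toReal_enorm]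
  norm_triangle f g := by
    rw [norm_def, norm_def, norm_def, Submodule.coe_add,
      ← ENNReal.toReal_add (ρ.eval_ne_top f) (ρ.eval_ne_top g)]
    exact ENNReal.toReal_mono (ENNReal.add_ne_top.2 ⟨ρ.eval_ne_top f, ρ.eval_ne_top g⟩)
      (ρ.eval_add_le _ _)
  norm_eq_zero_iff f := by
    rw [norm_def, ENNReal.toReal_eq_zero_iff, or_iff_left (ρ.eval_ne_top f),
      eval_eq_zero_iff, Submodule.coe_eq_zero]

instance instNormedAddCommGroupSpace : NormedAddCommGroup ρ.space :=
  NormedAddCommGroup.ofCore ρ.normedSpaceCore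

instance instNormedSpaceSpace : NormedSpace ℂ ρ.space :=
  NormedSpace.ofCore ρ.normedSpaceCore

theorem integrable_coe (f : ρ.space) :
    Integrable (f : UnitCirc →ₘ[normMeas] ℂ) normMeas := by
  refine ⟨AEEqFun.aestronglyMeasurable _, ?_⟩
  obtain ⟨C, hC⟩ := ρ.lintegral_le
  exact lt_of_le_of_lt (hC _ (aemeasurable_enorm _)) (ENNReal.mul_lt_top ENNReal.coe_lt_top f.2)

/-- The abstract Hardy space `H[X]`: the functions in `X` whose Fourier coefficients of negative
index vanish, with the norm of `X`. -/
def hardy : Submodule ℂ ρ.space where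
  carrier := {g | ∀ n : ℤ, n < 0 → fourierCoeff (g : UnitCirc →ₘ[normMeas] ℂ) n = 0}
  add_mem' := fun {f g} hf hg n hn => by
    have h : fourierCoeff ((f + g : ρ.space) : UnitCirc →ₘ[normMeas] ℂ) n
        = fourierCoeff (f : UnitCirc →ₘ[normMeas] ℂ) n
          + fourierCoeff (g : UnitCirc →ₘ[normMeas] ℂ) n := by
      simp only [fourierCoeff]
      rw [← integral_add ((ρ.integrable_coe f).fourier_smul _)
        ((ρ.integrable_coe g).fourier_smul _)]
      apply integral_congr_ae
      filter_upwards [AEEqFun.coeFn_add (f : UnitCirc →ₘ[normMeas] ℂ) g] with t ht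
      rw [Submodule.coe_add, ht, Pi.add_apply, smul_add]
    rw [h, hf n hn, hg n hn, add_zero]
  zero_mem' := fun n _ => by
    simp only [fourierCoeff]
    apply integral_eq_zero_of_ae
    filter_upwards [AEEqFun.coeFn_zero (α := UnitCirc) (β := ℂ) (μ := normMeas)] with t ht
    rw [Submodule.coe_zero, ht, Pi.zero_apply, smul_zero]
  smul_mem' := fun c f hf n hn => by
    have h : fourierCoeff ((c • f : ρ.space) : UnitCirc →ₘ[normMeas] ℂ) n
        = c * fourierCoeff (f : UnitCirc →ₘ[normMeas] ℂ) n := by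
      simp only [fourierCoeff]
      rw [← integral_const_mul]
      apply integral_congr_ae
      filter_upwards [AEEqFun.coeFn_smul c (f : UnitCirc →ₘ[normMeas] ℂ)] with t ht
      rw [Submodule.coe_smul, ht, Pi.smul_apply]
      simp only [smul_eq_mul]
      ring
    rw [h, hf n hn, mul_zero]

end BanachFunctionNorm

/-! ### The Riesz projection -/

/-- The truncated Cauchy singular integral
`(1 / πi) ∫_{|τ - t| > ε} f(τ) / (τ - t) dτ` at the point `t = e^{iθ}`, where `τ = e^{iσ}` and
`dτ = i e^{iσ} dσ`; here `dσ` has total mass `2π`. -/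
def cauchyTrunc (f : UnitCirc → ℂ) (ε : ℝ) (θ : UnitCirc) : ℂ :=
  ((Real.pi : ℂ) * Complex.I)⁻¹ *
    ∫ σ in {σ : UnitCirc | ε < ‖point σ - point θ‖},
      f σ / (point σ - point θ) * (Complex.I * point σ) ∂(volume : Measure UnitCirc)

/-- `u = S f`: at almost every point the principal value integral exists and equals `u`. -/
def HasCauchySingularIntegral (f u : UnitCirc → ℂ) : Prop :=
  ∀ᵐ θ ∂normMeas, Tendsto (fun ε : ℝ => cauchyTrunc f ε θ) (𝓝[>] 0) (𝓝 (u θ))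

/-- `g = P f = (f + S f) / 2` almost everywhere. -/
def HasRieszProjection (f g : UnitCirc → ℂ) : Prop :=
  ∃ u : UnitCirc → ℂ, HasCauchySingularIntegral f u ∧
    ∀ᵐ θ ∂normMeas, g θ = (f θ + u θ) / 2

/-- The Riesz projection maps `X` into `X` and is bounded there. -/
def RieszProjectionBounded (ρ : BanachFunctionNorm) : Prop :=
  ∃ C : ℝ, ∀ f : ρ.space, ∃ g : ρ.space,
    HasRieszProjection (f : UnitCirc →ₘ[normMeas] ℂ) (g : UnitCirc →ₘ[normMeas] ℂ) ∧
      ‖g‖ ≤ C * ‖f‖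

/-! ### Toeplitz operators, symbols and essential norms -/

/-- `A` is the Toeplitz operator with symbol `a`: `A f = P (a f)` for all `f ∈ H[X]`. -/
def IsToeplitz (ρ : BanachFunctionNorm) (a : Lp ℂ ∞ normMeas) (A : ρ.hardy →L[ℂ] ρ.hardy) : Prop :=
  ∀ f : ρ.hardy, HasRieszProjection
    (fun t => a t * ((f : ρ.space) : UnitCirc →ₘ[normMeas] ℂ) t)
    ((A f : ρ.space) : UnitCirc →ₘ[normMeas] ℂ)

open Classical in
/-- The Toeplitz operator `T(a) : H[X] → H[X]`, `T(a) f = P (a f)` (and `0` in the case where this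
formula does not define a bounded operator on `H[X]`). -/
def toeplitz (ρ : BanachFunctionNorm) (a : Lp ℂ ∞ normMeas) : ρ.hardy →L[ℂ] ρ.hardy :=
  if h : ∃ A, IsToeplitz ρ a A then h.choose else 0

/-- The set `C + H^∞ ⊆ L^∞`. -/
def cPlusHInfty : Set (Lp ℂ ∞ normMeas) :=
  {a | ∃ (g : C(UnitCirc, ℂ)) (h : Lp ℂ ∞ normMeas),
    (∀ n : ℤ, n < 0 → fourierCoeff h n = 0) ∧
      a = ContinuousMap.toLp (E := ℂ) ∞ normMeas ℂ g + h}

/-- The essential norm: the distance of `A` to the compact operators. -/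
def essNorm {E : Type*} [NormedAddCommGroup E] [NormedSpace ℂ E] (A : E →L[ℂ] E) : ℝ :=
  sInf {r | ∃ K : E →L[ℂ] E, IsCompactOperator K ∧ r = ‖A - K‖}

end AbstractHardy

end

/-!
# Essential norms of Toeplitz operators with symbols in `C + H^∞`

Write `R` for the Riesz projection and `S` for the Toeplitz operator with symbol `z⁻¹`.

*The singular integral as a limit of convolutions.* The truncated Cauchy integral is a convolution,
and its kernel differs from the Cauchy kernel of an exterior point by a kernel dominated by the
Poisson kernel, hence by an approximate identity in `L¹` (`tendsto_lintegral_diffKernel`). The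
exterior Cauchy integral of a function whose negative Fourier coefficients vanish is zero, so the
singular integral reproduces such a function whenever it exists
(`HasCauchySingularIntegral.eq_self`). No density of nice functions in `X` is used, and `X` need not
be separable. Together with the commutation relation of `R` with `z⁻¹` this determines `R` on all
functions with finitely many negative frequencies (`IsRiesz.fourierCoeff_apply`). The symbols with
finitely many negative frequencies are dense in `C + H^∞`, and both sides of the asserted norm
equality are continuous in the symbol, so only those symbols have to be considered.

*Upper bound.* If the frequencies of `b` are at least `-m`, then `T(b)` is the product of `S ^ m`
and the multiplication by `z ^ m b`, which has norm at most `‖b‖`. Since the essential norm is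
submultiplicative, `‖S‖ₑ ≤ 1` gives `‖T(b)‖ₑ ≤ ‖b‖` (`IsRiesz.essNorm_le`).

*Lower bound.* This holds without any hypothesis on `S` (`IsRiesz.le_essNorm`). For a trigonometric
polynomial `p` and large `n` the function `z ^ n p` is of Hardy class, and `T(b)` multiplies it by
`b`. A compact operator `K` maps a subsequence of the `z ^ n p` to a convergent sequence; its limit
is zero, because the averages of the subsequence tend to zero in norm. Hence
`‖b p‖ ≤ ‖T(b) - K‖ ‖p‖`, and letting `p` tend to the indicator function of a set on which `|b|` is
nearly maximal gives the bound. Both the statement on averages and the approximation of indicator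
functions need that bounded functions with a small mean have a small norm in `X`
(`IsRiesz.exists_norm_le_of_integral_le`). This follows from the boundedness of `R`: if
`q` is an analytic polynomial, real at the origin, with `0 ≤ Re q ≤ 1` on the circle, then
`log (1 + λ q)` has an imaginary part bounded by `π / 2`, its real part is at least
`log (1 + λ) Re q`, and its value at the origin is `log (1 + λ ∫ Re q)`. As `R` controls the real
part by the imaginary part and the value at the origin, `log (1 + λ) ‖Re q‖` stays bounded when `λ`
is the inverse of the mean of `Re q`.
-/

noncomputable section

namespace AbstractHardy

/-! ### The point map and convolutions on the circle -/

theorem point_eq_fourier (θ : UnitCirc) : point θ = fourier 1 θ := by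
  rw [fourier_one, point]

theorem norm_point (θ : UnitCirc) : ‖point θ‖ = 1 := Circle.norm_coe _

theorem point_ne_zero (θ : UnitCirc) : point θ ≠ 0 := Circle.coe_ne_zero _

theorem point_add (θ σ : UnitCirc) : point (θ + σ) = point θ * point σ := by
  simp [point, AddCircle.toCircle_add]

theorem point_neg (θ : UnitCirc) : point (-θ) = (starRingEnd ℂ) (point θ) := by
  simp only [point_eq_fourier, ← fourier_neg]
  simp [fourier_apply]

theorem point_neg_inv (θ : UnitCirc) : point (-θ) = (point θ)⁻¹ := by
  simp [point, AddCircle.toCircle_neg]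

theorem fourier_eq_zpow (n : ℤ) (θ : UnitCirc) : fourier n θ = point θ ^ n := by
  simp [fourier_apply, point, AddCircle.toCircle_zsmul]

theorem fourier_sub_apply (n : ℤ) (θ σ : UnitCirc) :
    fourier n (θ - σ) = fourier n θ * fourier (-n) σ := by
  simp only [fourier_eq_zpow, sub_eq_add_neg, point_add, point_neg_inv, mul_zpow, inv_zpow,
    zpow_neg]

theorem norm_fourier_apply (n : ℤ) (θ : UnitCirc) : ‖fourier n θ‖ = 1 := by
  rw [fourier_apply, Circle.norm_coe]

theorem continuous_point : Continuous point := by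
  simp_rw [funext point_eq_fourier]; exact (fourier 1).continuous

theorem point_eq_one_iff (θ : UnitCirc) : point θ = 1 ↔ θ = 0 := by
  constructor
  · intro h
    apply AddCircle.injective_toCircle (T := 2 * Real.pi) Real.two_pi_pos.ne'
    rw [AddCircle.toCircle_zero]
    exact Subtype.coe_injective (by simpa [point] using h)
  · rintro rfl; simp [point]

theorem normMeas_singleton (x : UnitCirc) : normMeas {x} = 0 := by
  have h : (volume : Measure UnitCirc) {x} = 0 := by
    have := AddCircle.volume_closedBall (T := 2 * Real.pi) (x := x) 0
    simpa [Real.pi_pos.le] using this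
  rw [AddCircle.volume_eq_smul_haarAddCircle, Measure.smul_apply, smul_eq_mul, mul_eq_zero] at h
  exact h.resolve_left (by simp [Real.pi_pos])

/-- The convolution `(K * f)(θ) = ∫ f(σ) K(θ - σ) dm(σ)` on the circle. -/
def circConv (K f : UnitCirc → ℂ) (θ : UnitCirc) : ℂ :=
  ∫ σ, f σ * K (θ - σ) ∂normMeas

theorem integrable_mul_kernel {K f : UnitCirc → ℂ} {M : ℝ} (hK : Measurable K)
    (hM : ∀ x, ‖K x‖ ≤ M) (hf : Integrable f normMeas) (θ : UnitCirc) :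
    Integrable (fun σ => f σ * K (θ - σ)) normMeas := by
  refine hf.mul_bdd (c := M) ?_ (ae_of_all _ fun σ => hM _)
  exact (hK.comp (measurable_const.sub measurable_id)).aestronglyMeasurable

theorem circConv_sub_right {K f g : UnitCirc → ℂ} {M : ℝ} (hK : Measurable K)
    (hM : ∀ x, ‖K x‖ ≤ M) (hf : Integrable f normMeas) (hg : Integrable g normMeas)
    (θ : UnitCirc) :
    circConv K (fun σ => f σ - g σ) θ = circConv K f θ - circConv K g θ := by
  simp only [circConv, sub_mul]
  exact integral_sub (integrable_mul_kernel hK hM hf θ) (integrable_mul_kernel hK hM hg θ)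

theorem circConv_sub_left {K L f : UnitCirc → ℂ} {M N : ℝ} (hK : Measurable K)
    (hM : ∀ x, ‖K x‖ ≤ M) (hL : Measurable L) (hN : ∀ x, ‖L x‖ ≤ N)
    (hf : Integrable f normMeas) (θ : UnitCirc) :
    circConv (fun x => K x - L x) f θ = circConv K f θ - circConv L f θ := by
  simp only [circConv, mul_sub]
  exact integral_sub (integrable_mul_kernel hK hM hf θ) (integrable_mul_kernel hL hN hf θ)

theorem aestronglyMeasurable_circConv {K f : UnitCirc → ℂ} (hK : Measurable K)
    (hf : AEStronglyMeasurable f normMeas) : AEStronglyMeasurable (circConv K f) normMeas := by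
  have h1 : AEStronglyMeasurable (fun z : UnitCirc × UnitCirc => f z.2 * K (z.1 - z.2))
      (normMeas.prod normMeas) :=
    (hf.comp_snd).mul (hK.comp (measurable_fst.sub measurable_snd)).aestronglyMeasurable
  exact h1.integral_prod_right'

/-- Young's inequality in `L¹`. -/
theorem lintegral_enorm_circConv_le {K f : UnitCirc → ℂ} (hK : Measurable K)
    (hf : AEStronglyMeasurable f normMeas) :
    ∫⁻ θ, ‖circConv K f θ‖ₑ ∂normMeas ≤
      (∫⁻ θ, ‖K θ‖ₑ ∂normMeas) * ∫⁻ θ, ‖f θ‖ₑ ∂normMeas := by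
  have h1 : AEMeasurable (Function.uncurry fun θ σ : UnitCirc => ‖f σ‖ₑ * ‖K (θ - σ)‖ₑ)
      (normMeas.prod normMeas) :=
    (hf.comp_snd).enorm.mul (hK.comp (measurable_fst.sub measurable_snd)).enorm.aemeasurable
  calc ∫⁻ θ, ‖circConv K f θ‖ₑ ∂normMeas
      ≤ ∫⁻ θ, ∫⁻ σ, ‖f σ‖ₑ * ‖K (θ - σ)‖ₑ ∂normMeas ∂normMeas := by
        refine lintegral_mono fun θ => ?_
        refine (enorm_integral_le_lintegral_enorm _).trans (le_of_eq ?_)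
        simp [enorm_mul]
    _ = ∫⁻ σ, ∫⁻ θ, ‖f σ‖ₑ * ‖K (θ - σ)‖ₑ ∂normMeas ∂normMeas := lintegral_lintegral_swap h1
    _ = ∫⁻ σ, ‖f σ‖ₑ * (∫⁻ θ, ‖K θ‖ₑ ∂normMeas) ∂normMeas := by
        refine lintegral_congr fun σ => ?_
        rw [lintegral_const_mul (f := fun θ => ‖K (θ - σ)‖ₑ) _
          (hK.comp (measurable_id.sub_const σ)).enorm]
        rw [lintegral_sub_right_eq_self (fun x => ‖K x‖ₑ) σ]
    _ = _ := by
        rw [lintegral_mul_const'' _ hf.enorm, mul_comm]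

theorem integrable_circConv {K f : UnitCirc → ℂ} {M : ℝ} (hK : Measurable K)
    (hM : ∀ x, ‖K x‖ ≤ M) (hf : Integrable f normMeas) :
    Integrable (circConv K f) normMeas := by
  refine ⟨aestronglyMeasurable_circConv hK hf.1, ?_⟩
  refine (lintegral_enorm_circConv_le hK hf.1).trans_lt (ENNReal.mul_lt_top ?_ hf.2)
  have : Integrable K normMeas :=
    (memLp_top_of_bound hK.aestronglyMeasurable M (ae_of_all _ hM)).integrable le_top
  exact this.2

theorem circConv_fourier_right (K : UnitCirc → ℂ) (n : ℤ) (θ : UnitCirc) :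
    circConv K (fourier n) θ = fourierCoeff K n * fourier n θ := by
  have h := integral_sub_left_eq_self (fun x => fourier n (θ - x) * K x) normMeas θ
  simp only [sub_sub_cancel] at h
  rw [circConv, h, fourierCoeff, ← integral_mul_const]
  refine integral_congr_ae (ae_of_all _ fun x => ?_)
  simp only [fourier_sub_apply, smul_eq_mul]
  ring

theorem circConv_fourier_left (f : UnitCirc → ℂ) (n : ℤ) (θ : UnitCirc) :
    circConv (fourier n) f θ = fourierCoeff f n * fourier n θ := by
  rw [circConv, fourierCoeff, ← integral_mul_const]
  refine integral_congr_ae (ae_of_all _ fun x => ?_)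
  simp only [fourier_sub_apply, smul_eq_mul]
  ring

/-! ### The truncated and the exterior Cauchy kernels -/

/-- The truncated Cauchy kernel, as a function of the difference of the angles. -/
def truncKernel (ε : ℝ) (x : UnitCirc) : ℂ :=
  open Classical in if ε < ‖1 - point x‖ then (1 - point x)⁻¹ else 0

/-- The Cauchy kernel for evaluation at the exterior point `(1 + ε) t`. -/
def extKernel (ε : ℝ) (x : UnitCirc) : ℂ := (1 - (1 + ε) * point x)⁻¹

/-- The truncated singular integral is a convolution. -/
theorem cauchyTrunc_eq_circConv (f : UnitCirc → ℂ) (ε : ℝ) (θ : UnitCirc) :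
    cauchyTrunc f ε θ = 2 * circConv (truncKernel ε) f θ := by
  have hk : ∀ σ, point σ - point θ = point σ * (1 - point (θ - σ)) := by
    intro σ
    have : point θ = point σ * point (θ - σ) := by rw [← point_add]; congr 1; abel
    rw [mul_sub, ← this, mul_one]
  have hn : ∀ σ, ‖point σ - point θ‖ = ‖1 - point (θ - σ)‖ := by
    intro σ; rw [hk, norm_mul, norm_point, one_mul]
  have hms : MeasurableSet {σ : UnitCirc | ε < ‖point σ - point θ‖} :=
    (isOpen_lt continuous_const (continuous_point.sub continuous_const).norm).measurableSet
  rw [cauchyTrunc, ← integral_indicator hms, AddCircle.volume_eq_smul_haarAddCircle,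
    integral_smul_measure, ENNReal.toReal_ofReal Real.two_pi_pos.le, circConv, Complex.real_smul,
    ← mul_assoc]
  have h2 : (fun σ => {σ : UnitCirc | ε < ‖point σ - point θ‖}.indicator
      (fun σ => f σ / (point σ - point θ) * (Complex.I * point σ)) σ) =
      fun σ => Complex.I * (f σ * truncKernel ε (θ - σ)) := by
    funext σ
    simp only [Set.indicator_apply, Set.mem_ofPred_eq, truncKernel, hn σ]
    split_ifs with h
    · rw [hk]
      have := point_ne_zero σ
      field_simp
    · simp
  rw [h2, integral_const_mul, ← mul_assoc]
  congr 1
  have := Complex.ofReal_ne_zero.2 Real.pi_pos.ne'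
  push_cast
  field_simp [Complex.I_ne_zero]

theorem measurable_truncKernel (ε : ℝ) : Measurable (truncKernel ε) := by
  classical
  refine Measurable.ite ?_ ?_ measurable_const
  · exact (isOpen_lt continuous_const (continuous_const.sub continuous_point).norm).measurableSet
  · exact (measurable_const.sub continuous_point.measurable).inv

theorem measurable_extKernel (ε : ℝ) : Measurable (extKernel ε) :=
  (measurable_const.sub (measurable_const.mul continuous_point.measurable)).inv

theorem norm_truncKernel_le {ε : ℝ} (hε : 0 < ε) (x : UnitCirc) : ‖truncKernel ε x‖ ≤ ε⁻¹ := by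
  rw [truncKernel]
  split_ifs with h
  · rw [norm_inv]; exact inv_anti₀ hε h.le
  · simpa using hε.le

theorem le_norm_one_sub {ε : ℝ} (hε : 0 < ε) (x : UnitCirc) :
    ε ≤ ‖1 - (1 + (ε : ℂ)) * point x‖ := by
  have h := norm_sub_norm_le ((1 + (ε : ℂ)) * point x) 1
  rw [norm_sub_rev] at h
  have h2 : ‖(1 + (ε : ℂ)) * point x‖ = 1 + ε := by
    rw [norm_mul, norm_point, mul_one]
    have : (1 + (ε : ℂ)) = ((1 + ε : ℝ) : ℂ) := by push_cast; rfl
    rw [this, Complex.norm_real, Real.norm_of_nonneg (by positivity)]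
  rw [h2, norm_one] at h
  linarith

theorem norm_extKernel_le {ε : ℝ} (hε : 0 < ε) (x : UnitCirc) : ‖extKernel ε x‖ ≤ ε⁻¹ := by
  rw [extKernel, norm_inv]; exact inv_anti₀ hε (le_norm_one_sub hε x)

/-- Functions with vanishing negative Fourier coefficients are annihilated by the Cauchy integral
at exterior points: expanding the kernel once multiplies the integral by `((1 + ε) t)⁻¹`. -/
theorem circConv_extKernel_eq_zero {f : UnitCirc → ℂ} (hf : Integrable f normMeas)
    (h0 : ∀ n : ℤ, n < 0 → fourierCoeff f n = 0) {ε : ℝ} (hε : 0 < ε) (θ : UnitCirc) :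
    circConv (extKernel ε) f θ = 0 := by
  set R : ℂ := 1 + (ε : ℂ) with hR
  have hRr : R = ((1 + ε : ℝ) : ℂ) := by rw [hR]; push_cast; rfl
  have hRn : ‖R‖ = 1 + ε := by
    rw [hRr, Complex.norm_real, Real.norm_of_nonneg (by positivity)]
  have hR0 : R ≠ 0 := by rw [← norm_pos_iff, hRn]; positivity
  have hint : ∀ k : ℤ, Integrable (fun σ => fourier k σ * f σ * extKernel ε (θ - σ)) normMeas :=
    fun k => integrable_mul_kernel (measurable_extKernel ε) (norm_extKernel_le hε)
      (hf.fourier_smul k) θ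
  set J : ℕ → ℂ := fun k => ∫ σ, fourier (k : ℤ) σ * f σ * extKernel ε (θ - σ) ∂normMeas with hJ
  have hstep : ∀ k, J k = (R * point θ)⁻¹ * J (k + 1) := by
    intro k
    have hz : ∫ σ, fourier ((k : ℤ) + 1) σ * f σ ∂normMeas = 0 := by
      have := h0 (-((k : ℤ) + 1)) (by omega)
      simpa only [fourierCoeff, neg_neg, smul_eq_mul] using this
    have : J k = ∫ σ, (R * point θ)⁻¹ * (fourier ((k : ℤ) + 1) σ * f σ * extKernel ε (θ - σ)
        - fourier ((k : ℤ) + 1) σ * f σ) ∂normMeas := by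
      refine integral_congr_ae (ae_of_all _ fun σ => ?_)
      have hp : point (θ - σ) = point θ * (point σ)⁻¹ := by
        rw [sub_eq_add_neg, point_add, point_neg_inv]
      have hne : 1 - R * point (θ - σ) ≠ 0 := by
        rw [← norm_pos_iff]; exact hε.trans_le (le_norm_one_sub hε _)
      have h1 : extKernel ε (θ - σ) - 1 = R * point (θ - σ) * extKernel ε (θ - σ) := by
        rw [extKernel, ← hR]; field_simp; ring
      have h2 : fourier ((k : ℤ) + 1) σ = fourier (k : ℤ) σ * point σ := by
        rw [fourier_add, point_eq_fourier]
      have h3 : fourier ((k : ℤ) + 1) σ * f σ * extKernel ε (θ - σ)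
          - fourier ((k : ℤ) + 1) σ * f σ
          = fourier ((k : ℤ) + 1) σ * f σ * (extKernel ε (θ - σ) - 1) := by ring
      simp only
      rw [h3, h1, h2, hp]
      have := point_ne_zero σ
      have := point_ne_zero θ
      field_simp
    rw [this, integral_const_mul, integral_sub (hint _) (by
      simpa only [smul_eq_mul] using hf.fourier_smul _), hz, sub_zero, hJ]
    simp
  have hpow : ∀ k, J 0 = ((R * point θ)⁻¹) ^ k * J k := by
    intro k
    induction k with
    | zero => simp
    | succ k ih => rw [ih, hstep k, pow_succ]; ring
  have hbd : ∀ k, ‖J k‖ ≤ (∫ σ, ‖f σ‖ ∂normMeas) * ε⁻¹ := by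
    intro k
    rw [← integral_mul_const]
    refine norm_integral_le_of_norm_le (hf.norm.mul_const _) (ae_of_all _ fun σ => ?_)
    rw [norm_mul, norm_mul, norm_fourier_apply, one_mul]
    exact mul_le_mul_of_nonneg_left (norm_extKernel_le hε _) (norm_nonneg _)
  have hle : ∀ k : ℕ, ‖J 0‖ ≤ ((1 + ε)⁻¹) ^ k * ((∫ σ, ‖f σ‖ ∂normMeas) * ε⁻¹) := by
    intro k
    rw [hpow k, norm_mul, norm_pow, norm_inv, norm_mul, norm_point, hRn, mul_one]
    exact mul_le_mul_of_nonneg_left (hbd k) (by positivity)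
  have hlim : Tendsto (fun k : ℕ => ((1 + ε)⁻¹) ^ k * ((∫ σ, ‖f σ‖ ∂normMeas) * ε⁻¹)) atTop
      (𝓝 (0 * ((∫ σ, ‖f σ‖ ∂normMeas) * ε⁻¹))) :=
    (tendsto_pow_atTop_nhds_zero_of_lt_one (by positivity)
      (inv_lt_one_of_one_lt₀ (by linarith))).mul_const _
  have h00 : ‖J 0‖ ≤ 0 := by
    have := ge_of_tendsto' hlim hle
    simpa using this
  have : J 0 = 0 := norm_le_zero_iff.1 h00
  rw [← this, hJ]
  simp [circConv]

/-! ### The difference of the two kernels is an approximate identity -/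

/-- Twice the difference of the truncated and the exterior Cauchy kernel. -/
def diffKernel (ε : ℝ) (x : UnitCirc) : ℂ := 2 * (truncKernel ε x - extKernel ε x)

theorem measurable_diffKernel (ε : ℝ) : Measurable (diffKernel ε) :=
  ((measurable_truncKernel ε).sub (measurable_extKernel ε)).const_mul 2

theorem norm_diffKernel_le {ε : ℝ} (hε : 0 < ε) (x : UnitCirc) :
    ‖diffKernel ε x‖ ≤ 2 * (ε⁻¹ + ε⁻¹) := by
  rw [diffKernel, norm_mul, Complex.norm_ofNat]
  gcongr
  exact (norm_sub_le _ _).trans (add_le_add (norm_truncKernel_le hε x) (norm_extKernel_le hε x))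

theorem integrable_of_bounded {K : UnitCirc → ℂ} {M : ℝ} (hK : Measurable K)
    (hM : ∀ x, ‖K x‖ ≤ M) : Integrable K normMeas :=
  (memLp_top_of_bound hK.aestronglyMeasurable M (ae_of_all _ hM)).integrable le_top

theorem integral_extKernel {ε : ℝ} (hε : 0 < ε) : ∫ x, extKernel ε x ∂normMeas = 0 := by
  have hi : Integrable (fourier 0 : C(UnitCirc, ℂ)) normMeas :=
    integrable_of_bounded (fourier 0).continuous.measurable (fun x => (norm_fourier_apply 0 x).le)
  have h := circConv_extKernel_eq_zero hi (fun n hn => by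
    rw [fourierCoeff_fourier]; simp [hn.ne]) hε 0
  rw [circConv_fourier_right, fourier_zero, mul_one] at h
  simpa [fourierCoeff] using h

/-- The difference kernel is dominated by twice the Poisson kernel of the exterior point. -/
theorem norm_diffKernel_le_poisson {ε : ℝ} (hε : 0 < ε) (x : UnitCirc) :
    ‖diffKernel ε x‖ ≤ 2 * (1 - 2 * (extKernel ε x).re) := by
  set q : ℂ := 1 - (1 + (ε : ℂ)) * point x with hq
  have hqε : ε ≤ ‖q‖ := le_norm_one_sub hε x
  have hq0 : 0 < ‖q‖ := hε.trans_le hqε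
  have hRn : ‖(1 + (ε : ℂ)) * point x‖ = 1 + ε := by
    rw [norm_mul, norm_point, mul_one]
    have : (1 + (ε : ℂ)) = ((1 + ε : ℝ) : ℂ) := by push_cast; rfl
    rw [this, Complex.norm_real, Real.norm_of_nonneg (by positivity)]
  -- the Poisson kernel in terms of the exterior Cauchy kernel
  have hpois : 1 - 2 * (extKernel ε x).re = ε * (2 + ε) / ‖q‖ ^ 2 := by
    have h1 : ‖q - 1‖ ^ 2 = (1 + ε) ^ 2 := by
      rw [← hRn, hq]; congr 1; rw [← norm_neg]; congr 1; ring
    rw [extKernel, ← hq, Complex.inv_re, ← Complex.normSq_eq_norm_sq]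
    rw [← Complex.normSq_eq_norm_sq] at h1
    have h2 : Complex.normSq q ≠ 0 := by
      rw [Complex.normSq_eq_norm_sq]; positivity
    field_simp
    rw [Complex.normSq_apply] at h1 ⊢
    simp only [Complex.sub_re, Complex.one_re, Complex.sub_im, Complex.one_im, sub_zero] at h1
    linarith
  have hdiff : q - (1 - point x) = -(ε * point x) := by rw [hq]; ring
  have hle1 : ‖q‖ ≤ ‖1 - point x‖ + ε := by
    have : q = (1 - point x) + -(ε * point x) := by rw [← hdiff]; ring
    rw [this]
    refine (norm_add_le _ _).trans ?_
    rw [norm_neg, norm_mul, norm_point, mul_one, Complex.norm_real, Real.norm_of_nonneg hε.le]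
  have hmain : ‖truncKernel ε x - extKernel ε x‖ ≤ 2 * ε / ‖q‖ ^ 2 := by
    rw [truncKernel, extKernel, ← hq]
    split_ifs with h
    · have hw0 : 0 < ‖1 - point x‖ := hε.trans h
      have : (1 - point x)⁻¹ - q⁻¹ = -(ε * point x) / ((1 - point x) * q) := by
        rw [← hdiff]
        have := norm_pos_iff.1 hw0
        have := norm_pos_iff.1 hq0
        field_simp
      rw [this, norm_div, norm_neg, norm_mul, norm_mul, norm_point, mul_one, Complex.norm_real,
        Real.norm_of_nonneg hε.le, div_le_div_iff₀ (by positivity) (by positivity)]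
      have : ‖q‖ ≤ 2 * ‖1 - point x‖ := by linarith
      nlinarith [mul_le_mul_of_nonneg_left this (mul_pos hε hq0).le]
    · have : ‖q‖ ≤ 2 * ε := by linarith
      rw [zero_sub, norm_neg, norm_inv, inv_eq_one_div, div_le_div_iff₀ hq0 (by positivity)]
      nlinarith
  rw [hpois, diffKernel, norm_mul, Complex.norm_ofNat]
  refine mul_le_mul_of_nonneg_left (hmain.trans ?_) (by norm_num)
  exact div_le_div_of_nonneg_right (by nlinarith) (by positivity)

/-- The difference kernels are bounded in `L¹`, because the Poisson kernel has mass one. -/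
theorem lintegral_diffKernel_le {ε : ℝ} (hε : 0 < ε) :
    ∫⁻ x, ‖diffKernel ε x‖ₑ ∂normMeas ≤ 2 := by
  have hi := integrable_of_bounded (measurable_diffKernel ε) (norm_diffKernel_le hε)
  have he := integrable_of_bounded (measurable_extKernel ε) (norm_extKernel_le hε)
  have hre : ∫ x, (extKernel ε x).re ∂normMeas = 0 := by
    have := integral_re he
    simpa [integral_extKernel hε] using this
  rw [← ofReal_integral_norm_eq_lintegral_enorm hi]
  have : ∫ x, ‖diffKernel ε x‖ ∂normMeas ≤ 2 := by
    calc ∫ x, ‖diffKernel ε x‖ ∂normMeas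
        ≤ ∫ x, 2 * (1 - 2 * (extKernel ε x).re) ∂normMeas := by
          refine integral_mono hi.norm ?_ (norm_diffKernel_le_poisson hε)
          exact (((integrable_const (1 : ℝ)).sub (he.re.const_mul 2)).const_mul 2)
      _ = 2 := by
          have he2 : Integrable (fun x => 2 * (extKernel ε x).re) normMeas := he.re.const_mul 2
          rw [integral_const_mul, integral_sub (integrable_const _) he2, integral_const_mul, hre]
          simp
  calc ENNReal.ofReal (∫ x, ‖diffKernel ε x‖ ∂normMeas) ≤ ENNReal.ofReal 2 :=
        ENNReal.ofReal_le_ofReal this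
    _ = 2 := by simp

/-- Characters are Lipschitz at the identity. -/
theorem norm_zpow_sub_one_le {z : ℂ} (hz : ‖z‖ = 1) (n : ℤ) : ‖z ^ n - 1‖ ≤ |n| * ‖1 - z‖ := by
  have hnat : ∀ k : ℕ, ‖z ^ k - 1‖ ≤ k * ‖1 - z‖ := by
    intro k
    induction k with
    | zero => simp
    | succ k ih =>
      have : z ^ (k + 1) - 1 = z * (z ^ k - 1) + -(1 - z) := by ring
      rw [this]
      refine (norm_add_le _ _).trans ?_
      rw [norm_mul, hz, one_mul, norm_neg]
      push_cast
      linarith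
  obtain ⟨k, rfl | rfl⟩ := n.eq_nat_or_neg
  · simpa using hnat k
  · have hz0 : z ≠ 0 := by rw [← norm_pos_iff, hz]; norm_num
    have h1 : z ^ (-(k : ℤ)) - 1 = -(z ^ k)⁻¹ * (z ^ k - 1) := by
      rw [zpow_neg, zpow_natCast]
      have := pow_ne_zero k hz0
      field_simp
      ring
    rw [h1, norm_mul, norm_neg, norm_inv, norm_pow, hz, one_pow, inv_one, one_mul]
    simpa using hnat k

theorem ae_ne_zero : ∀ᵐ x ∂normMeas, x ≠ 0 := by
  rw [ae_iff]; simpa using normMeas_singleton 0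

theorem tendsto_diffKernel {x : UnitCirc} (hx : x ≠ 0) :
    Tendsto (fun ε : ℝ => diffKernel ε x) (𝓝[>] 0) (𝓝 0) := by
  have hw : 1 - point x ≠ 0 := by
    rw [sub_ne_zero]; exact fun h => hx ((point_eq_one_iff x).1 h.symm)
  have hlim : Tendsto (fun ε : ℝ => 2 * ((1 - point x)⁻¹ - extKernel ε x)) (𝓝[>] 0) (𝓝 0) := by
    have hc : ContinuousAt (fun ε : ℝ => 2 * ((1 - point x)⁻¹ - extKernel ε x)) 0 := by
      refine continuousAt_const.mul (continuousAt_const.sub ?_)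
      refine ContinuousAt.inv₀ (by fun_prop) (by simpa using hw)
    have h0 : (2 : ℂ) * ((1 - point x)⁻¹ - extKernel 0 x) = 0 := by simp [extKernel]
    have := hc.tendsto
    rw [h0] at this
    exact this.mono_left nhdsWithin_le_nhds
  refine hlim.congr' ?_
  have : ∀ᶠ ε : ℝ in 𝓝[>] 0, ε < ‖1 - point x‖ :=
    (eventually_lt_nhds (norm_pos_iff.2 hw)).filter_mono nhdsWithin_le_nhds
  filter_upwards [this] with ε hε
  rw [diffKernel, truncKernel, if_pos hε]

theorem norm_diffKernel_mul_le {ε : ℝ} (hε : 0 < ε) (x : UnitCirc) :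
    ‖diffKernel ε x‖ * ‖1 - point x‖ ≤ 6 := by
  have h1 : ‖truncKernel ε x‖ * ‖1 - point x‖ ≤ 1 := by
    rw [truncKernel]
    split_ifs with h
    · rw [norm_inv, inv_mul_cancel₀ (hε.trans h).ne']
    · simp
  have h2 : ‖extKernel ε x‖ * ‖1 - point x‖ ≤ 2 := by
    have hq := le_norm_one_sub hε x
    have h3 : 1 - point x = (1 - (1 + (ε : ℂ)) * point x) + ε * point x := by ring
    have h4 : ‖1 - point x‖ ≤ 2 * ‖1 - (1 + (ε : ℂ)) * point x‖ := by
      calc ‖1 - point x‖ ≤ ‖1 - (1 + (ε : ℂ)) * point x‖ + ‖ε * point x‖ := by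
            conv_lhs => rw [h3]
            exact norm_add_le _ _
        _ ≤ 2 * ‖1 - (1 + (ε : ℂ)) * point x‖ := by
            rw [norm_mul, norm_point, mul_one, Complex.norm_real, Real.norm_of_nonneg hε.le]
            linarith
    rw [extKernel, norm_inv, inv_mul_le_iff₀ (hε.trans_le hq)]
    linarith
  have h5 : ‖diffKernel ε x‖ ≤ 2 * (‖truncKernel ε x‖ + ‖extKernel ε x‖) := by
    rw [diffKernel, norm_mul, Complex.norm_ofNat]
    exact mul_le_mul_of_nonneg_left (norm_sub_le _ _) (by norm_num)
  nlinarith [norm_nonneg (1 - point x)]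

/-- The difference kernel concentrates at the origin and has total mass tending to one: the
exterior kernel has mass zero and the truncated one has mass about `1 / 2`. -/
theorem tendsto_fourierCoeff_diffKernel (n : ℤ) :
    Tendsto (fun ε : ℝ => fourierCoeff (diffKernel ε) n) (𝓝[>] 0) (𝓝 1) := by
  -- the mean of the truncated kernel, by the symmetry `x ↦ -x`
  have htrunc : ∀ ε : ℝ, 0 < ε → 2 * ∫ x, truncKernel ε x ∂normMeas =
      ∫ x, Set.indicator {x : UnitCirc | ε < ‖1 - point x‖} (fun _ => (1 : ℂ)) x ∂normMeas := by
    intro ε hε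
    have hi := integrable_of_bounded (measurable_truncKernel ε) (norm_truncKernel_le hε)
    have hneg := integral_neg_eq_self (truncKernel ε) normMeas
    rw [two_mul]
    nth_rewrite 2 [← hneg]
    rw [← integral_add hi hi.comp_neg]
    refine integral_congr_ae (ae_of_all _ fun x => ?_)
    have hnorm : ‖1 - point (-x)‖ = ‖1 - point x‖ := by
      rw [point_neg, ← map_one (starRingEnd ℂ), ← map_sub, Complex.norm_conj, map_one]
    simp only [truncKernel, Set.indicator_apply, Set.mem_ofPred_eq, hnorm]
    split_ifs with h
    · have hw : 1 - point x ≠ 0 := norm_pos_iff.1 (hε.trans h)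
      have hp := point_ne_zero x
      have hw' : point x - 1 ≠ 0 := by rw [← neg_ne_zero]; simpa using hw
      rw [point_neg_inv]
      have : 1 - (point x)⁻¹ = (point x - 1) / point x := by field_simp
      rw [this, inv_div]
      have h3 : (1 - point x)⁻¹ = -(point x - 1)⁻¹ := by rw [← inv_neg, neg_sub]
      rw [h3]
      field_simp
      ring
    · simp
  have hmean : Tendsto (fun ε : ℝ => ∫ x, diffKernel ε x ∂normMeas) (𝓝[>] 0) (𝓝 1) := by
    have h1 : Tendsto (fun ε : ℝ => ∫ x, Set.indicator {x : UnitCirc | ε < ‖1 - point x‖}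
        (fun _ => (1 : ℂ)) x ∂normMeas) (𝓝[>] 0) (𝓝 (∫ _, (1 : ℂ) ∂normMeas)) := by
      refine tendsto_integral_filter_of_dominated_convergence (fun _ => 1) ?_ ?_
        (integrable_const _) ?_
      · refine Eventually.of_forall fun ε => ?_
        exact (measurable_const.indicator (isOpen_lt continuous_const
          (continuous_const.sub continuous_point).norm).measurableSet).aestronglyMeasurable
      · refine Eventually.of_forall fun ε => ae_of_all _ fun x => ?_
        rw [Set.indicator_apply]; split_ifs <;> simp
      · filter_upwards [ae_ne_zero] with x hx
        have hw : 1 - point x ≠ 0 := by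
          rw [sub_ne_zero]; exact fun h => hx ((point_eq_one_iff x).1 h.symm)
        refine tendsto_const_nhds.congr' ?_
        have : ∀ᶠ ε : ℝ in 𝓝[>] 0, ε < ‖1 - point x‖ :=
          (eventually_lt_nhds (norm_pos_iff.2 hw)).filter_mono nhdsWithin_le_nhds
        filter_upwards [this] with ε hε
        exact (Set.indicator_of_mem (f := fun _ => (1 : ℂ))
          (show x ∈ {x : UnitCirc | ε < ‖1 - point x‖} from hε)).symm
    simp only [integral_const, probReal_univ, one_smul] at h1
    refine h1.congr' ?_
    filter_upwards [self_mem_nhdsWithin] with ε hε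
    have hε : 0 < ε := hε
    rw [← htrunc ε hε]
    simp only [diffKernel]
    rw [integral_const_mul, integral_sub
      (integrable_of_bounded (measurable_truncKernel ε) (norm_truncKernel_le hε))
      (integrable_of_bounded (measurable_extKernel ε) (norm_extKernel_le hε)),
      integral_extKernel hε, sub_zero]
  -- off the origin the kernel is small, at the origin the character is close to one
  have hconc : Tendsto (fun ε : ℝ => ∫ x, (fourier (-n) x - 1) * diffKernel ε x ∂normMeas)
      (𝓝[>] 0) (𝓝 (∫ _, (0 : ℂ) ∂normMeas)) := by
    refine tendsto_integral_filter_of_dominated_convergence (fun _ => |(-n : ℤ)| * 6) ?_ ?_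
        (integrable_const _) ?_
    · refine Eventually.of_forall fun ε => ?_
      exact (((fourier (-n)).continuous.measurable.sub_const 1).mul
        (measurable_diffKernel ε)).aestronglyMeasurable
    · filter_upwards [self_mem_nhdsWithin] with ε hε
      refine ae_of_all _ fun x => ?_
      have hε : 0 < ε := hε
      rw [norm_mul, fourier_eq_zpow]
      calc _ ≤ (|(-n : ℤ)| * ‖1 - point x‖) * ‖diffKernel ε x‖ :=
            mul_le_mul_of_nonneg_right (norm_zpow_sub_one_le (norm_point x) _) (norm_nonneg _)
        _ = |(-n : ℤ)| * (‖diffKernel ε x‖ * ‖1 - point x‖) := by ring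
        _ ≤ _ := mul_le_mul_of_nonneg_left (norm_diffKernel_mul_le hε x) (by positivity)
    · filter_upwards [ae_ne_zero] with x hx
      simpa using (tendsto_diffKernel hx).const_mul (fourier (-n) x - 1)
  have := hconc.add hmean
  rw [integral_zero, zero_add] at this
  refine this.congr' ?_
  filter_upwards [self_mem_nhdsWithin] with ε hε
  have hε : 0 < ε := hε
  have hi := integrable_of_bounded (measurable_diffKernel ε) (norm_diffKernel_le hε)
  have h2 : Integrable (fun x => (fourier (-n) x - 1) * diffKernel ε x) normMeas := by
    have := (hi.fourier_smul (-n)).sub hi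
    refine this.congr (ae_of_all _ fun x => ?_)
    simp only [Pi.sub_apply, smul_eq_mul]; ring
  rw [← integral_add h2 hi, fourierCoeff]
  refine integral_congr_ae (ae_of_all _ fun x => ?_)
  simp only [smul_eq_mul]; ring

/-! ### Trigonometric polynomials -/

/-- The space of trigonometric polynomials. -/
abbrev trigPoly : Submodule ℂ C(UnitCirc, ℂ) := Submodule.span ℂ (Set.range fourier)

theorem integrable_continuousMap (g : C(UnitCirc, ℂ)) : Integrable g normMeas :=
  integrable_of_bounded g.continuous.measurable g.norm_coe_le_norm

theorem exists_trigPoly_norm_sub_le (g : C(UnitCirc, ℂ)) {η : ℝ} (hη : 0 < η) :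
    ∃ p ∈ trigPoly, ‖g - p‖ ≤ η := by
  have h : g ∈ (trigPoly).topologicalClosure := by
    rw [span_fourier_closure_eq_top]; trivial
  obtain ⟨p, hp, hd⟩ := Metric.mem_closure_iff.1 h η hη
  exact ⟨p, hp, by rw [← dist_eq_norm]; exact hd.le⟩

theorem lintegral_enorm_continuousMap_le (g : C(UnitCirc, ℂ)) :
    ∫⁻ x, ‖g x‖ₑ ∂normMeas ≤ ENNReal.ofReal ‖g‖ := by
  calc ∫⁻ x, ‖g x‖ₑ ∂normMeas ≤ ∫⁻ _, ENNReal.ofReal ‖g‖ ∂normMeas := by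
        refine lintegral_mono fun x => ?_
        rw [← ofReal_norm]
        exact ENNReal.ofReal_le_ofReal (g.norm_coe_le_norm x)
    _ = _ := by simp

theorem exists_trigPoly_lintegral_sub_le {f : UnitCirc → ℂ} (hf : Integrable f normMeas)
    {η : ℝ≥0∞} (hη : η ≠ 0) : ∃ p ∈ trigPoly, ∫⁻ x, ‖f x - p x‖ₑ ∂normMeas ≤ η := by
  wlog hfin : η ≠ ∞ generalizing η
  · obtain ⟨p, hp, h⟩ := this (η := 1) one_ne_zero ENNReal.one_ne_top
    exact ⟨p, hp, h.trans (by rw [not_not.1 hfin]; exact le_top)⟩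
  have hη2 : η / 2 ≠ 0 := (ENNReal.half_pos hη).ne'
  obtain ⟨g, hg, hgi⟩ := hf.exists_boundedContinuous_lintegral_sub_le hη2
  obtain ⟨p, hp, hgp⟩ := exists_trigPoly_norm_sub_le g.toContinuousMap
    (ENNReal.toReal_pos hη2 (by finiteness))
  refine ⟨p, hp, ?_⟩
  calc ∫⁻ x, ‖f x - p x‖ₑ ∂normMeas
      ≤ ∫⁻ x, (‖f x - g x‖ₑ + ‖(g.toContinuousMap - p) x‖ₑ) ∂normMeas := by
        refine lintegral_mono fun x => ?_
        have : f x - p x = (f x - g x) + (g.toContinuousMap - p) x := by simp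
        rw [this]
        exact enorm_add_le _ _
    _ = ∫⁻ x, ‖f x - g x‖ₑ ∂normMeas + ∫⁻ x, ‖(g.toContinuousMap - p) x‖ₑ ∂normMeas :=
        lintegral_add_left' (hf.1.sub hgi.1).enorm _
    _ ≤ η / 2 + η / 2 := by
        refine add_le_add hg ((lintegral_enorm_continuousMap_le _).trans ?_)
        exact (ENNReal.ofReal_le_ofReal hgp).trans ENNReal.ofReal_toReal_le
    _ = η := ENNReal.add_halves η

theorem fourierCoeff_trigPoly_eq_zero {p : C(UnitCirc, ℂ)} (hp : p ∈ trigPoly) :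
    ∃ m : ℕ, ∀ n : ℤ, n < -m → fourierCoeff p n = 0 := by
  induction hp using Submodule.span_induction with
  | mem x hx =>
    obtain ⟨k, rfl⟩ := hx
    refine ⟨k.natAbs, fun n hn => ?_⟩
    rw [fourierCoeff_fourier, Pi.single_apply, if_neg (by omega)]
  | zero => exact ⟨0, fun n _ => by simp [fourierCoeff]⟩
  | add p q _ _ hp hq =>
    obtain ⟨m, hm⟩ := hp
    obtain ⟨k, hk⟩ := hq
    refine ⟨max m k, fun n hn => ?_⟩
    rw [ContinuousMap.coe_add,
      fourierCoeff.add (integrable_continuousMap p) (integrable_continuousMap q), Pi.add_apply,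
      hm n (by push_cast at hn; omega), hk n (by push_cast at hn; omega), add_zero]
  | smul c p _ hp =>
    obtain ⟨m, hm⟩ := hp
    refine ⟨m, fun n hn => ?_⟩
    rw [ContinuousMap.coe_smul, fourierCoeff.const_smul, hm n hn, smul_zero]

theorem tendsto_lintegral_diffKernel_trigPoly {p : C(UnitCirc, ℂ)} (hp : p ∈ trigPoly) :
    Tendsto (fun ε : ℝ => ∫⁻ θ, ‖circConv (diffKernel ε) p θ - p θ‖ₑ ∂normMeas)
      (𝓝[>] 0) (𝓝 0) := by
  induction hp using Submodule.span_induction with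
  | mem x hx =>
    obtain ⟨n, rfl⟩ := hx
    have h1 : ∀ ε : ℝ, ∫⁻ θ, ‖circConv (diffKernel ε) (fourier n) θ - fourier n θ‖ₑ ∂normMeas
        = ‖fourierCoeff (diffKernel ε) n - 1‖ₑ := by
      intro ε
      have : ∀ θ, ‖circConv (diffKernel ε) (fourier n) θ - fourier n θ‖ₑ
          = ‖fourierCoeff (diffKernel ε) n - 1‖ₑ := by
        intro θ
        rw [circConv_fourier_right]
        have : fourierCoeff (diffKernel ε) n * fourier n θ - fourier n θ
          = (fourierCoeff (diffKernel ε) n - 1) * fourier n θ := by ring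
        rw [this, enorm_mul, ← ofReal_norm (fourier n θ), norm_fourier_apply]
        simp
      rw [lintegral_congr this]
      simp
    simp_rw [h1]
    have := ((tendsto_fourierCoeff_diffKernel n).sub_const 1).enorm
    simpa using this
  | zero => simp [circConv]
  | add p q _ _ hp hq =>
    have hs := hp.add hq
    rw [add_zero] at hs
    refine tendsto_of_tendsto_of_tendsto_of_le_of_le' tendsto_const_nhds hs
      (Eventually.of_forall fun _ => zero_le) ?_
    filter_upwards [self_mem_nhdsWithin] with ε hε
    have hε : 0 < ε := hε
    have hm : AEMeasurable (fun θ => ‖circConv (diffKernel ε) p θ - p θ‖ₑ) normMeas :=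
      ((aestronglyMeasurable_circConv (measurable_diffKernel ε)
        p.continuous.aestronglyMeasurable).sub p.continuous.aestronglyMeasurable).enorm
    rw [← lintegral_add_left' hm]
    refine lintegral_mono fun θ => ?_
    have h3 : circConv (diffKernel ε) (p + q : C(UnitCirc, ℂ)) θ
        = circConv (diffKernel ε) p θ + circConv (diffKernel ε) q θ := by
      simp only [circConv, ContinuousMap.add_apply, add_mul]
      exact integral_add
        (integrable_mul_kernel (measurable_diffKernel ε) (norm_diffKernel_le hε)
          (integrable_continuousMap p) θ)
        (integrable_mul_kernel (measurable_diffKernel ε) (norm_diffKernel_le hε)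
          (integrable_continuousMap q) θ)
    rw [h3, ContinuousMap.add_apply, add_sub_add_comm]
    exact enorm_add_le _ _
  | smul c p _ hp =>
    have hs := ENNReal.Tendsto.const_mul (a := ‖c‖ₑ) hp (Or.inr enorm_ne_top)
    rw [mul_zero] at hs
    refine hs.congr fun ε => ?_
    rw [← lintegral_const_mul' _ _ enorm_ne_top]
    refine lintegral_congr fun θ => ?_
    have h3 : circConv (diffKernel ε) (c • p : C(UnitCirc, ℂ)) θ
        = c * circConv (diffKernel ε) p θ := by
      simp only [circConv, ContinuousMap.smul_apply, smul_eq_mul, mul_assoc]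
      exact integral_const_mul _ _
    rw [h3, ContinuousMap.smul_apply, smul_eq_mul, ← mul_sub, enorm_mul]

/-- The difference kernel is an approximate identity in `L¹`. -/
theorem tendsto_lintegral_diffKernel {f : UnitCirc → ℂ} (hf : Integrable f normMeas) :
    Tendsto (fun ε : ℝ => ∫⁻ θ, ‖circConv (diffKernel ε) f θ - f θ‖ₑ ∂normMeas)
      (𝓝[>] 0) (𝓝 0) := by
  rw [ENNReal.tendsto_nhds_zero]
  intro η hη
  have hη4 : η / 4 ≠ 0 := (ENNReal.div_pos hη.ne' (by finiteness)).ne'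
  obtain ⟨p, hp, hfp⟩ := exists_trigPoly_lintegral_sub_le hf hη4
  have hpi := integrable_continuousMap p
  filter_upwards [self_mem_nhdsWithin,
    (ENNReal.tendsto_nhds_zero.1 (tendsto_lintegral_diffKernel_trigPoly hp)) (η / 4)
      (pos_iff_ne_zero.2 hη4)] with ε hε hεp
  have hε : 0 < ε := hε
  have hK := measurable_diffKernel ε
  have hfpi : Integrable (fun x => f x - p x) normMeas := hf.sub hpi
  calc ∫⁻ θ, ‖circConv (diffKernel ε) f θ - f θ‖ₑ ∂normMeas
      ≤ ∫⁻ θ, (‖circConv (diffKernel ε) (fun x => f x - p x) θ‖ₑ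
          + (‖circConv (diffKernel ε) p θ - p θ‖ₑ + ‖f θ - p θ‖ₑ)) ∂normMeas := by
        refine lintegral_mono fun θ => ?_
        have : circConv (diffKernel ε) f θ - f θ
            = circConv (diffKernel ε) (fun x => f x - p x) θ
              + ((circConv (diffKernel ε) p θ - p θ) - (f θ - p θ)) := by
          rw [circConv_sub_right hK (norm_diffKernel_le hε) hf hpi]; ring
        rw [this]
        exact (enorm_add_le _ _).trans (add_le_add le_rfl (enorm_sub_le))
    _ = ∫⁻ θ, ‖circConv (diffKernel ε) (fun x => f x - p x) θ‖ₑ ∂normMeas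
          + (∫⁻ θ, ‖circConv (diffKernel ε) p θ - p θ‖ₑ ∂normMeas
            + ∫⁻ θ, ‖f θ - p θ‖ₑ ∂normMeas) := by
        rw [lintegral_add_left' (aestronglyMeasurable_circConv hK hfpi.1).enorm,
          lintegral_add_right' _ hfpi.1.enorm]
    _ ≤ 2 * (η / 4) + (η / 4 + η / 4) := by
        refine add_le_add ((lintegral_enorm_circConv_le hK hfpi.1).trans ?_) (add_le_add hεp hfp)
        exact mul_le_mul' (lintegral_diffKernel_le hε) hfp
    _ = η := by
        rw [two_mul]
        have : η / 4 + η / 4 = η / 2 := by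
          rw [← ENNReal.add_div, ← two_mul, ENNReal.div_eq_inv_mul, ENNReal.div_eq_inv_mul,
            ← mul_assoc]
          congr 1
          rw [show (4 : ℝ≥0∞) = 2 * 2 by norm_num, ENNReal.mul_inv (by simp) (by simp),
            mul_assoc, ENNReal.inv_mul_cancel (by simp) (by simp), mul_one]
        rw [this, ENNReal.add_halves]

/-! ### The Cauchy singular integral on functions of Hardy class -/

/-- A summable function with vanishing negative Fourier coefficients is reproduced by the singular
integral: its truncated integrals are the convolutions with the difference kernels, because the
exterior Cauchy integral vanishes. -/
theorem HasCauchySingularIntegral.eq_self {f u : UnitCirc → ℂ} (hf : Integrable f normMeas)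
    (h0 : ∀ n : ℤ, n < 0 → fourierCoeff f n = 0) (hu : HasCauchySingularIntegral f u) :
    u =ᵐ[normMeas] f := by
  obtain ⟨s, -, hs0, hs⟩ := exists_seq_strictAnti_tendsto (0 : ℝ)
  have hsn : Tendsto s atTop (𝓝[>] 0) :=
    tendsto_nhdsWithin_iff.2 ⟨hs, Eventually.of_forall hs0⟩
  have htr : ∀ j θ, cauchyTrunc f (s j) θ = circConv (diffKernel (s j)) f θ := by
    intro j θ
    have h1 : circConv (diffKernel (s j)) f θ = 2 * circConv
        (fun x => truncKernel (s j) x - extKernel (s j) x) f θ := by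
      simp only [circConv, diffKernel]
      rw [← integral_const_mul]
      exact integral_congr_ae (ae_of_all _ fun σ => by ring)
    rw [h1, circConv_sub_left (measurable_truncKernel _) (norm_truncKernel_le (hs0 j))
      (measurable_extKernel _) (norm_extKernel_le (hs0 j)) hf,
      circConv_extKernel_eq_zero hf h0 (hs0 j), sub_zero, cauchyTrunc_eq_circConv]
  have hlim := (tendsto_lintegral_diffKernel hf).comp hsn
  have hm : ∀ j, AEStronglyMeasurable (fun θ => circConv (diffKernel (s j)) f θ - f θ) normMeas :=
    fun j => (aestronglyMeasurable_circConv (measurable_diffKernel _) hf.1).sub hf.1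
  have hconv : ∀ᵐ θ ∂normMeas, Tendsto (fun j => circConv (diffKernel (s j)) f θ - f θ) atTop
      (𝓝 (u θ - f θ)) := by
    filter_upwards [hu] with θ h2
    refine ((h2.comp hsn).sub_const (f θ)).congr fun j => ?_
    simp only [Function.comp_apply, htr]
  have hmu : AEStronglyMeasurable (fun θ => u θ - f θ) normMeas :=
    aestronglyMeasurable_of_tendsto_ae atTop hm hconv
  have hfat : ∫⁻ θ, ‖u θ - f θ‖ₑ ∂normMeas ≤ 0 := by
    calc ∫⁻ θ, ‖u θ - f θ‖ₑ ∂normMeas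
        = ∫⁻ θ, liminf (fun j => ‖circConv (diffKernel (s j)) f θ - f θ‖ₑ) atTop ∂normMeas := by
          refine lintegral_congr_ae (hconv.mono fun θ h => ?_)
          exact h.enorm.liminf_eq.symm
      _ ≤ _ := lintegral_liminf_le' fun j => (hm j).enorm
      _ = 0 := hlim.liminf_eq
  filter_upwards [(lintegral_eq_zero_iff' hmu.enorm).1 (le_antisymm hfat zero_le)] with θ h1
  exact sub_eq_zero.1 (enorm_eq_zero.1 h1)

theorem fourierCoeff_fourier_mul (f : UnitCirc → ℂ) (k n : ℤ) :
    fourierCoeff (fun t => fourier k t * f t) n = fourierCoeff f (n - k) := by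
  simp only [fourierCoeff, smul_eq_mul]
  refine integral_congr_ae (ae_of_all _ fun t => ?_)
  simp only
  rw [← mul_assoc, ← fourier_add]
  congr 3
  ring

theorem enorm_fourierCoeff_le (f : UnitCirc → ℂ) (n : ℤ) :
    ‖fourierCoeff f n‖ₑ ≤ ∫⁻ t, ‖f t‖ₑ ∂normMeas := by
  refine (enorm_integral_le_lintegral_enorm _).trans (le_of_eq ?_)
  refine lintegral_congr fun t => ?_
  rw [enorm_smul, ← ofReal_norm (fourier (-n) t), norm_fourier_apply]
  simp

theorem fourierCoeff_sub {f g : UnitCirc → ℂ} (hf : Integrable f normMeas)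
    (hg : Integrable g normMeas) (n : ℤ) :
    fourierCoeff (fun t => f t - g t) n = fourierCoeff f n - fourierCoeff g n := by
  simp only [fourierCoeff, smul_sub]
  exact integral_sub (hf.fourier_smul _) (hg.fourier_smul _)

/-- The product of a bounded and a summable function of Hardy class is of Hardy class. The second
factor is approximated in `L¹` by its convolutions with trigonometric polynomials close to the
difference kernel; these are analytic polynomials. -/
theorem fourierCoeff_mul_eq_zero {h f : UnitCirc → ℂ} {M : ℝ} (hh : AEStronglyMeasurable h normMeas)
    (hM : ∀ᵐ t ∂normMeas, ‖h t‖ ≤ M) (hh0 : ∀ n : ℤ, n < 0 → fourierCoeff h n = 0)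
    (hf : Integrable f normMeas) (hf0 : ∀ n : ℤ, n < 0 → fourierCoeff f n = 0)
    {n : ℤ} (hn : n < 0) : fourierCoeff (fun t => h t * f t) n = 0 := by
  have hhi : Integrable h normMeas := (memLp_top_of_bound hh M hM).integrable le_top
  have hmul : ∀ {g : UnitCirc → ℂ}, Integrable g normMeas →
      Integrable (fun t => h t * g t) normMeas := fun hg => hg.bdd_mul hh hM
  -- convolutions with trigonometric polynomials
  have hpoly : ∀ q ∈ trigPoly, fourierCoeff (fun t => h t * circConv q f t) n = 0 := by
    intro q hq
    induction hq using Submodule.span_induction with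
    | mem x hx =>
      obtain ⟨k, rfl⟩ := hx
      have : (fun t => h t * circConv (fourier k) f t)
          = fun t => fourierCoeff f k * (fourier k t * h t) := by
        funext t; rw [circConv_fourier_left]; ring
      rw [this, fourierCoeff.const_mul, fourierCoeff_fourier_mul]
      rcases lt_or_ge k 0 with hk | hk
      · rw [hf0 k hk, zero_mul]
      · rw [hh0 _ (by omega), mul_zero]
    | zero => simp [circConv, fourierCoeff]
    | add p q _ _ hp hq =>
      have h1 : (fun t => h t * circConv (p + q : C(UnitCirc, ℂ)) f t)
          = (fun t => h t * circConv p f t) + fun t => h t * circConv q f t := by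
        funext t
        simp only [Pi.add_apply, circConv, ContinuousMap.add_apply]
        rw [← mul_add, ← integral_add
          (integrable_mul_kernel p.continuous.measurable p.norm_coe_le_norm hf t)
          (integrable_mul_kernel q.continuous.measurable q.norm_coe_le_norm hf t)]
        simp only [mul_add]
      rw [h1, fourierCoeff.add (hmul (integrable_circConv p.continuous.measurable
        p.norm_coe_le_norm hf)) (hmul (integrable_circConv q.continuous.measurable
        q.norm_coe_le_norm hf)), Pi.add_apply, hp, hq, add_zero]
    | smul c p _ hp =>
      have h1 : (fun t => h t * circConv (c • p : C(UnitCirc, ℂ)) f t)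
          = fun t => c * (h t * circConv p f t) := by
        funext t
        have : circConv (c • p : C(UnitCirc, ℂ)) f t = c * circConv p f t := by
          simp only [circConv, ContinuousMap.smul_apply, smul_eq_mul]
          rw [← integral_const_mul]
          exact integral_congr_ae (ae_of_all _ fun σ => by ring)
        rw [this]; ring
      rw [h1, fourierCoeff.const_mul, hp, mul_zero]
  set S : ℝ≥0∞ := ∫⁻ t, ‖f t‖ₑ ∂normMeas with hS
  have hSfin : S ≠ ∞ := hf.2.ne
  have hM' : ∀ᵐ t ∂normMeas, ‖h t‖ₑ ≤ ENNReal.ofReal M := by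
    filter_upwards [hM] with t ht
    rw [← ofReal_norm]; exact ENNReal.ofReal_le_ofReal ht
  have hbound : ∀ η : ℝ≥0∞, η ≠ 0 → ‖fourierCoeff (fun t => h t * f t) n‖ₑ ≤
      ENNReal.ofReal M * (η + η * S) := by
    intro η hη
    obtain ⟨ε, hε, hεη⟩ := (eventually_mem_nhdsWithin.and
      ((ENNReal.tendsto_nhds_zero.1 (tendsto_lintegral_diffKernel hf)) η
        (pos_iff_ne_zero.2 hη))).exists
    have hε : 0 < ε := hε
    have hD := measurable_diffKernel ε
    have hDb := norm_diffKernel_le hε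
    obtain ⟨q, hq, hDq⟩ := exists_trigPoly_lintegral_sub_le (integrable_of_bounded hD hDb) hη
    have hqc := integrable_circConv q.continuous.measurable q.norm_coe_le_norm hf
    have h1 : fourierCoeff (fun t => h t * f t) n
        = fourierCoeff (fun t => h t * f t - h t * circConv q f t) n := by
      rw [fourierCoeff_sub (hmul hf) (hmul hqc), hpoly q hq, sub_zero]
    have hDm : Measurable fun x => diffKernel ε x - q x := hD.sub q.continuous.measurable
    rw [h1]
    calc _ ≤ ∫⁻ t, ‖h t * f t - h t * circConv q f t‖ₑ ∂normMeas := enorm_fourierCoeff_le _ _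
      _ ≤ ∫⁻ t, ENNReal.ofReal M * (‖circConv (diffKernel ε) f t - f t‖ₑ
            + ‖circConv (fun x => diffKernel ε x - q x) f t‖ₑ) ∂normMeas := by
          refine lintegral_mono_ae ?_
          filter_upwards [hM'] with t ht
          rw [← mul_sub, enorm_mul]
          refine mul_le_mul' ht ?_
          rw [circConv_sub_left hD hDb q.continuous.measurable q.norm_coe_le_norm hf]
          have : f t - circConv q f t = (circConv (diffKernel ε) f t - circConv q f t)
            - (circConv (diffKernel ε) f t - f t) := by ring
          rw [this, add_comm]
          exact enorm_sub_le
      _ = ENNReal.ofReal M * (∫⁻ t, ‖circConv (diffKernel ε) f t - f t‖ₑ ∂normMeas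
            + ∫⁻ t, ‖circConv (fun x => diffKernel ε x - q x) f t‖ₑ ∂normMeas) := by
          rw [lintegral_const_mul' _ _ ENNReal.ofReal_ne_top,
            lintegral_add_right' _ (aestronglyMeasurable_circConv hDm hf.1).enorm]
      _ ≤ _ := by
          refine mul_le_mul' le_rfl (add_le_add hεη ?_)
          exact (lintegral_enorm_circConv_le hDm hf.1).trans (mul_le_mul' hDq le_rfl)
  have hlim : Tendsto (fun η : ℝ≥0∞ => ENNReal.ofReal M * (η + η * S)) (𝓝[>] 0)
      (𝓝 (ENNReal.ofReal M * (0 + 0 * S))) := by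
    refine ENNReal.Tendsto.const_mul ?_ (Or.inr ENNReal.ofReal_ne_top)
    refine Tendsto.add (tendsto_id.mono_left nhdsWithin_le_nhds) ?_
    exact ENNReal.Tendsto.mul_const (tendsto_id.mono_left nhdsWithin_le_nhds) (Or.inr hSfin)
  have hle := ge_of_tendsto hlim (by
    filter_upwards [self_mem_nhdsWithin] with η hη
    exact hbound η (ne_of_gt hη))
  simpa using hle

/-! ### Algebra of the singular integral -/

theorem HasCauchySingularIntegral.ae_unique {f u v : UnitCirc → ℂ}
    (hu : HasCauchySingularIntegral f u) (hv : HasCauchySingularIntegral f v) :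
    u =ᵐ[normMeas] v := by
  filter_upwards [hu, hv] with θ h1 h2
  exact tendsto_nhds_unique h1 h2

theorem cauchyTrunc_congr {f g : UnitCirc → ℂ} (h : f =ᵐ[normMeas] g) (ε : ℝ) (θ : UnitCirc) :
    cauchyTrunc f ε θ = cauchyTrunc g ε θ := by
  rw [cauchyTrunc_eq_circConv, cauchyTrunc_eq_circConv, circConv, circConv]
  congr 1
  exact integral_congr_ae (h.mono fun σ hσ => by simp only [hσ])

theorem HasCauchySingularIntegral.congr {f g u : UnitCirc → ℂ}
    (hu : HasCauchySingularIntegral f u) (h : f =ᵐ[normMeas] g) :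
    HasCauchySingularIntegral g u :=
  Eventually.mono hu fun θ hθ => hθ.congr fun ε => cauchyTrunc_congr h ε θ

theorem HasCauchySingularIntegral.congr_right {f u v : UnitCirc → ℂ}
    (hu : HasCauchySingularIntegral f u) (h : u =ᵐ[normMeas] v) :
    HasCauchySingularIntegral f v := by
  filter_upwards [hu, h] with θ h1 h2
  rwa [← h2]

theorem HasCauchySingularIntegral.add {f g u v : UnitCirc → ℂ} (hf : Integrable f normMeas)
    (hg : Integrable g normMeas) (hu : HasCauchySingularIntegral f u)
    (hv : HasCauchySingularIntegral g v) :
    HasCauchySingularIntegral (fun t => f t + g t) (fun t => u t + v t) := by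
  filter_upwards [hu, hv] with θ h1 h2
  refine (h1.add h2).congr' ?_
  filter_upwards [self_mem_nhdsWithin] with ε hε
  simp only [cauchyTrunc_eq_circConv, circConv, add_mul]
  rw [integral_add (integrable_mul_kernel (measurable_truncKernel ε) (norm_truncKernel_le hε) hf θ)
    (integrable_mul_kernel (measurable_truncKernel ε) (norm_truncKernel_le hε) hg θ), mul_add]

theorem HasCauchySingularIntegral.const_mul {f u : UnitCirc → ℂ} (c : ℂ)
    (hu : HasCauchySingularIntegral f u) :
    HasCauchySingularIntegral (fun t => c * f t) (fun t => c * u t) := by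
  filter_upwards [hu] with θ h1
  refine (h1.const_mul c).congr fun ε => ?_
  simp only [cauchyTrunc_eq_circConv, circConv, mul_assoc]
  rw [integral_const_mul]
  ring

/-- The integrals over the complements of shrinking neighbourhoods of a point converge to the
whole integral. -/
theorem tendsto_integral_indicator {f : UnitCirc → ℂ} (hf : Integrable f normMeas)
    (θ : UnitCirc) :
    Tendsto (fun ε : ℝ => ∫ σ, Set.indicator {σ : UnitCirc | ε < ‖1 - point (θ - σ)‖} f σ
      ∂normMeas) (𝓝[>] 0) (𝓝 (∫ σ, f σ ∂normMeas)) := by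
  refine tendsto_integral_filter_of_dominated_convergence (fun σ => ‖f σ‖) ?_ ?_ hf.norm ?_
  · refine Eventually.of_forall fun ε => hf.1.indicator ?_
    exact (isOpen_lt continuous_const (continuous_const.sub
      (continuous_point.comp (continuous_const.sub continuous_id))).norm).measurableSet
  · exact Eventually.of_forall fun ε => ae_of_all _ fun σ => norm_indicator_le_norm_self _ _
  · have : ∀ᵐ σ ∂normMeas, σ ≠ θ := by
      rw [ae_iff]; simpa using normMeas_singleton θ
    filter_upwards [this] with σ hσ
    have hw : 1 - point (θ - σ) ≠ 0 := by
      rw [sub_ne_zero]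
      exact fun h => hσ (sub_eq_zero.1 ((point_eq_one_iff _).1 h.symm)).symm
    refine tendsto_const_nhds.congr' ?_
    have : ∀ᶠ ε : ℝ in 𝓝[>] 0, ε < ‖1 - point (θ - σ)‖ :=
      (eventually_lt_nhds (norm_pos_iff.2 hw)).filter_mono nhdsWithin_le_nhds
    filter_upwards [this] with ε hε
    exact (Set.indicator_of_mem
      (show σ ∈ {σ : UnitCirc | ε < ‖1 - point (θ - σ)‖} from hε) _).symm

/-- Commutation of the singular integral with the multiplication by `z⁻¹`: the numerator
`τ⁻¹ - t⁻¹` cancels the singularity. -/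
theorem HasCauchySingularIntegral.fourier_neg_one_mul {f u : UnitCirc → ℂ}
    (hf : Integrable f normMeas) (hu : HasCauchySingularIntegral f u) :
    HasCauchySingularIntegral (fun t => fourier (-1) t * f t)
      (fun t => fourier (-1) t * (u t - 2 * fourierCoeff f 0)) := by
  filter_upwards [hu] with θ h1
  have h2 := (tendsto_integral_indicator hf θ).const_mul 2
  have h0 : ∫ σ, f σ ∂normMeas = fourierCoeff f 0 := by simp [fourierCoeff]
  rw [h0] at h2
  refine ((h1.sub h2).const_mul (fourier (-1) θ)).congr' ?_
  · filter_upwards [self_mem_nhdsWithin] with ε hε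
    have hms : MeasurableSet {σ : UnitCirc | ε < ‖1 - point (θ - σ)‖} :=
      (isOpen_lt continuous_const (continuous_const.sub
      (continuous_point.comp (continuous_const.sub continuous_id))).norm).measurableSet
    rw [cauchyTrunc_eq_circConv, cauchyTrunc_eq_circConv, circConv, circConv, ← mul_sub,
      ← integral_sub
        (integrable_mul_kernel (measurable_truncKernel ε) (norm_truncKernel_le hε) hf θ)
        (hf.indicator hms), ← mul_assoc, mul_comm _ (2 : ℂ), mul_assoc, ← integral_const_mul]
    congr 1
    refine integral_congr_ae (ae_of_all _ fun σ => ?_)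
    simp only [truncKernel, Set.indicator_apply, Set.mem_ofPred_eq]
    split_ifs with h
    · have hw : 1 - point (θ - σ) ≠ 0 := norm_pos_iff.1 ((show 0 < ε from hε).trans h)
      have h3 : fourier (-1) σ = fourier (-1) θ * point (θ - σ) := by
        rw [sub_eq_add_neg, point_add, point_neg_inv, fourier_eq_zpow, fourier_eq_zpow,
          zpow_neg_one, zpow_neg_one, ← mul_assoc, inv_mul_cancel₀ (point_ne_zero θ), one_mul]
      rw [h3]
      field_simp
      ring
    · simp

/-- The singular integral of the complex conjugate function. -/
theorem HasCauchySingularIntegral.conj {f u : UnitCirc → ℂ}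
    (hf : Integrable f normMeas) (hu : HasCauchySingularIntegral f u) :
    HasCauchySingularIntegral (fun t => (starRingEnd ℂ) (f t))
      (fun t => (starRingEnd ℂ) (2 * fourierCoeff f 0 - u t)) := by
  filter_upwards [hu] with θ h1
  have h2 := (tendsto_integral_indicator hf θ).const_mul 2
  have h0 : ∫ σ, f σ ∂normMeas = fourierCoeff f 0 := by simp [fourierCoeff]
  rw [h0] at h2
  refine ((Complex.continuous_conj.tendsto _).comp (h2.sub h1)).congr' ?_
  filter_upwards [self_mem_nhdsWithin] with ε hε
  have hms : MeasurableSet {σ : UnitCirc | ε < ‖1 - point (θ - σ)‖} :=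
    (isOpen_lt continuous_const (continuous_const.sub
    (continuous_point.comp (continuous_const.sub continuous_id))).norm).measurableSet
  simp only [Function.comp_apply]
  rw [cauchyTrunc_eq_circConv, cauchyTrunc_eq_circConv, circConv, circConv, ← mul_sub,
    ← integral_sub (hf.indicator hms)
      (integrable_mul_kernel (measurable_truncKernel ε) (norm_truncKernel_le hε) hf θ),
    map_mul, ← integral_conj, map_ofNat]
  congr 1
  refine integral_congr_ae (ae_of_all _ fun σ => ?_)
  simp only [truncKernel, Set.indicator_apply, Set.mem_ofPred_eq]
  split_ifs with h
  · have hw : 1 - point (θ - σ) ≠ 0 := norm_pos_iff.1 ((show 0 < ε from hε).trans h)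
    have hp := point_ne_zero (θ - σ)
    have h4 : (starRingEnd ℂ) (point (θ - σ)) = (point (θ - σ))⁻¹ := by
      rw [← point_neg, point_neg_inv]
    have h5 : (starRingEnd ℂ) ((1 - point (θ - σ))⁻¹) = 1 - (1 - point (θ - σ))⁻¹ := by
      rw [map_inv₀, map_sub, map_one, h4]
      have : 1 - (point (θ - σ))⁻¹ = -(1 - point (θ - σ)) / point (θ - σ) := by
        field_simp; ring
      rw [this, inv_div]
      field_simp
      ring
    rw [map_sub, map_mul, h5]
    ring
  · simp

/-! ### Multiplication operators on a Banach function space -/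

theorem ae_norm_le_norm_Linfty (a : Lp ℂ ∞ normMeas) : ∀ᵐ t ∂normMeas, ‖a t‖ ≤ ‖a‖ := by
  filter_upwards [ae_le_eLpNormEssSup (f := a) (μ := normMeas)] with t ht
  rw [Lp.norm_def, eLpNorm_exponent_top, ← toReal_enorm]
  refine ENNReal.toReal_mono ?_ ht
  rw [← eLpNorm_exponent_top]
  exact Lp.eLpNorm_ne_top a

namespace BanachFunctionNorm

variable (ρ : BanachFunctionNorm)

variable {ρ} in
theorem ext_ae {f g : ρ.space} (h : f.1 =ᵐ[normMeas] g.1) : f = g := Subtype.ext (AEEqFun.ext h)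

variable {ρ} in
theorem coe_add_ae (f g : ρ.space) : (f + g).1 =ᵐ[normMeas] fun t => f.1 t + g.1 t :=
  AEEqFun.coeFn_add f.1 g.1

variable {ρ} in
theorem coe_sub_ae (f g : ρ.space) : (f - g).1 =ᵐ[normMeas] fun t => f.1 t - g.1 t :=
  AEEqFun.coeFn_sub f.1 g.1

variable {ρ} in
theorem coe_smul_ae (c : ℂ) (f : ρ.space) : (c • f).1 =ᵐ[normMeas] fun t => c * f.1 t :=
  AEEqFun.coeFn_smul c f.1

theorem rho_le_mul {f g : UnitCirc → ℝ≥0∞} (c : ℝ≥0) (hf : AEMeasurable f normMeas)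
    (hg : AEMeasurable g normMeas) (h : ∀ᵐ t ∂normMeas, f t ≤ c * g t) :
    ρ.rho f ≤ c * ρ.rho g :=
  (ρ.mono _ _ (hg.const_mul _) hf h).trans (ρ.smul c g hg).le

variable {ρ} in
theorem norm_le_mul {f g : ρ.space} {c : ℝ} (hc : 0 ≤ c)
    (h : ∀ᵐ t ∂normMeas, ‖f.1 t‖ ≤ c * ‖g.1 t‖) : ‖f‖ ≤ c * ‖g‖ := by
  lift c to ℝ≥0 using hc
  have h1 : ρ.eval f.1 ≤ c * ρ.eval g.1 := by
    refine ρ.rho_le_mul c (aemeasurable_enorm _) (aemeasurable_enorm _) (h.mono fun t ht => ?_)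
    rw [enorm_eq_nnnorm, enorm_eq_nnnorm, ← ENNReal.coe_mul, ENNReal.coe_le_coe]
    exact_mod_cast ht
  have h2 := ENNReal.toReal_mono (ENNReal.mul_ne_top ENNReal.coe_ne_top (ρ.eval_ne_top g)) h1
  rwa [ENNReal.toReal_mul, ENNReal.coe_toReal] at h2

/-- Bounded measurable functions belong to the space. -/
theorem exists_of_bounded {φ : UnitCirc → ℂ} {M : ℝ} (hφ : AEStronglyMeasurable φ normMeas)
    (hM : ∀ᵐ t ∂normMeas, ‖φ t‖ ≤ M) : ∃ g : ρ.space, g.1 =ᵐ[normMeas] φ := by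
  refine ⟨⟨AEEqFun.mk φ hφ, ?_⟩, AEEqFun.coeFn_mk φ hφ⟩
  have h1 : ρ.eval (AEEqFun.mk φ hφ) ≤ (M.toNNReal : ℝ≥0∞) * ρ.rho (fun _ => 1) := by
    refine ρ.rho_le_mul _ (aemeasurable_enorm _) aemeasurable_const ?_
    filter_upwards [hM, AEEqFun.coeFn_mk φ hφ] with t h1 h2
    rw [h2, mul_one, ← ofReal_norm]
    exact ENNReal.ofReal_le_ofReal h1
  exact h1.trans_lt (ENNReal.mul_lt_top ENNReal.coe_lt_top ρ.one_lt_top)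

theorem mul_mem_space (a : Lp ℂ ∞ normMeas) (f : ρ.space) :
    (a : UnitCirc →ₘ[normMeas] ℂ) * f.1 ∈ ρ.space := by
  have h1 : ρ.eval ((a : UnitCirc →ₘ[normMeas] ℂ) * f.1) ≤ (‖a‖₊ : ℝ≥0∞) * ρ.eval f.1 := by
    refine ρ.rho_le_mul _ (aemeasurable_enorm _) (aemeasurable_enorm _) ?_
    filter_upwards [AEEqFun.coeFn_mul (a : UnitCirc →ₘ[normMeas] ℂ) f.1,
      ae_norm_le_norm_Linfty a] with t h1 h2
    rw [h1, Pi.mul_apply, enorm_mul]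
    refine mul_le_mul' ?_ le_rfl
    rw [enorm_eq_nnnorm, ENNReal.coe_le_coe]
    exact h2
  exact h1.trans_lt (ENNReal.mul_lt_top ENNReal.coe_lt_top f.2)

/-- The operator of multiplication by a bounded function. -/
def mulCLM (a : Lp ℂ ∞ normMeas) : ρ.space →L[ℂ] ρ.space :=
  LinearMap.mkContinuous
    { toFun := fun f => ⟨(a : UnitCirc →ₘ[normMeas] ℂ) * f.1, ρ.mul_mem_space a f⟩
      map_add' := fun f g => by
        apply ext_ae
        filter_upwards [AEEqFun.coeFn_mul (a : UnitCirc →ₘ[normMeas] ℂ) f.1,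
          AEEqFun.coeFn_mul (a : UnitCirc →ₘ[normMeas] ℂ) g.1,
          AEEqFun.coeFn_mul (a : UnitCirc →ₘ[normMeas] ℂ) (f + g).1, coe_add_ae f g,
          coe_add_ae ⟨(a : UnitCirc →ₘ[normMeas] ℂ) * f.1, ρ.mul_mem_space a f⟩
            ⟨(a : UnitCirc →ₘ[normMeas] ℂ) * g.1, ρ.mul_mem_space a g⟩] with t h1 h2 h3 h4 h5
        rw [h3, h5, h1, h2, Pi.mul_apply, Pi.mul_apply, Pi.mul_apply, h4, mul_add]
      map_smul' := fun c f => by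
        apply ext_ae
        filter_upwards [AEEqFun.coeFn_mul (a : UnitCirc →ₘ[normMeas] ℂ) f.1,
          AEEqFun.coeFn_mul (a : UnitCirc →ₘ[normMeas] ℂ) (c • f).1, coe_smul_ae c f,
          coe_smul_ae c ⟨(a : UnitCirc →ₘ[normMeas] ℂ) * f.1, ρ.mul_mem_space a f⟩]
          with t h1 h2 h3 h4
        rw [h2, RingHom.id_apply, h4, h1, Pi.mul_apply, Pi.mul_apply, h3]
        ring }
    ‖a‖ (fun f => by
      refine norm_le_mul (norm_nonneg a) ?_
      filter_upwards [AEEqFun.coeFn_mul (a : UnitCirc →ₘ[normMeas] ℂ) f.1,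
        ae_norm_le_norm_Linfty a] with t h1 h2
      simp only [LinearMap.coe_mk, AddHom.coe_mk]
      rw [h1, Pi.mul_apply, norm_mul]
      exact mul_le_mul_of_nonneg_right h2 (norm_nonneg _))

theorem mulCLM_ae (a : Lp ℂ ∞ normMeas) (f : ρ.space) :
    (ρ.mulCLM a f).1 =ᵐ[normMeas] fun t => a t * f.1 t :=
  AEEqFun.coeFn_mul (a : UnitCirc →ₘ[normMeas] ℂ) f.1

theorem norm_mulCLM_le (a : Lp ℂ ∞ normMeas) : ‖ρ.mulCLM a‖ ≤ ‖a‖ :=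
  LinearMap.mkContinuous_norm_le _ (norm_nonneg a) _

/-- The operator of multiplication by `z ^ k`. -/
def shift (k : ℤ) : ρ.space →L[ℂ] ρ.space := ρ.mulCLM (fourierLp ∞ k)

theorem shift_ae (k : ℤ) (f : ρ.space) :
    (ρ.shift k f).1 =ᵐ[normMeas] fun t => fourier k t * f.1 t := by
  filter_upwards [ρ.mulCLM_ae (fourierLp ∞ k) f, coeFn_fourierLp (T := 2 * Real.pi) ∞ k]
    with t h1 h2
  rw [shift, h1, h2]

variable {ρ} in
theorem norm_congr {f g : ρ.space} (h : ∀ᵐ t ∂normMeas, ‖f.1 t‖ = ‖g.1 t‖) : ‖f‖ = ‖g‖ := by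
  apply le_antisymm
  · simpa using norm_le_mul (f := f) (g := g) zero_le_one (h.mono fun t ht => by simp [ht])
  · simpa using norm_le_mul (f := g) (g := f) zero_le_one (h.mono fun t ht => by simp [ht])

theorem norm_shift (k : ℤ) (f : ρ.space) : ‖ρ.shift k f‖ = ‖f‖ := by
  apply norm_congr
  filter_upwards [ρ.shift_ae k f] with t h
  rw [h, norm_mul, norm_fourier_apply, one_mul]

theorem shift_shift (j k : ℤ) (f : ρ.space) : ρ.shift j (ρ.shift k f) = ρ.shift (j + k) f := by
  apply ext_ae
  filter_upwards [ρ.shift_ae k f, ρ.shift_ae j (ρ.shift k f), ρ.shift_ae (j + k) f]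
    with t h1 h2 h3
  rw [h2, h1, h3, fourier_add, mul_assoc]

theorem shift_zero (f : ρ.space) : ρ.shift 0 f = f := by
  apply ext_ae
  filter_upwards [ρ.shift_ae 0 f] with t h
  rw [h, fourier_zero, one_mul]

/-- The constant function `1`. -/
def one : ρ.space :=
  (ρ.exists_of_bounded (φ := fun _ => 1) (M := 1) aestronglyMeasurable_const
    (ae_of_all _ fun _ => by simp)).choose

theorem one_ae : ρ.one.1 =ᵐ[normMeas] fun _ => 1 :=
  (ρ.exists_of_bounded (φ := fun _ => 1) (M := 1) aestronglyMeasurable_const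
    (ae_of_all _ fun _ => by simp)).choose_spec

theorem fourierCoeff_coe_add (f g : ρ.space) (n : ℤ) :
    fourierCoeff (f + g).1 n = fourierCoeff f.1 n + fourierCoeff g.1 n := by
  rw [fourierCoeff_congr_ae (coe_add_ae f g)]
  exact congrFun (fourierCoeff.add (ρ.integrable_coe f) (ρ.integrable_coe g)) n

theorem fourierCoeff_coe_sub (f g : ρ.space) (n : ℤ) :
    fourierCoeff (f - g).1 n = fourierCoeff f.1 n - fourierCoeff g.1 n := by
  rw [fourierCoeff_congr_ae (coe_sub_ae f g)]
  exact fourierCoeff_sub (ρ.integrable_coe f) (ρ.integrable_coe g) n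

theorem fourierCoeff_coe_smul (c : ℂ) (f : ρ.space) (n : ℤ) :
    fourierCoeff (c • f).1 n = c * fourierCoeff f.1 n := by
  rw [fourierCoeff_congr_ae (coe_smul_ae c f), fourierCoeff.const_mul]

theorem fourierCoeff_shift (k : ℤ) (f : ρ.space) (n : ℤ) :
    fourierCoeff (ρ.shift k f).1 n = fourierCoeff f.1 (n - k) := by
  rw [fourierCoeff_congr_ae (ρ.shift_ae k f), fourierCoeff_fourier_mul]

theorem fourierCoeff_one (n : ℤ) : fourierCoeff ρ.one.1 n = if n = 0 then 1 else 0 := by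
  have : ρ.one.1 =ᵐ[normMeas] (fourier 0 : C(UnitCirc, ℂ)) := by
    filter_upwards [ρ.one_ae] with t h; rw [h, fourier_zero]
  rw [fourierCoeff_congr_ae this, fourierCoeff_fourier, Pi.single_apply]

/-- The Fourier coefficients are continuous on the space, uniformly in the index. -/
theorem exists_norm_fourierCoeff_le : ∃ C : ℝ, ∀ (f : ρ.space) (n : ℤ),
    ‖fourierCoeff f.1 n‖ ≤ C * ‖f‖ := by
  obtain ⟨C, hC⟩ := ρ.lintegral_le
  refine ⟨C, fun f n => ?_⟩
  have h := (enorm_fourierCoeff_le f.1 n).trans (hC _ (aemeasurable_enorm f.1))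
  have := ENNReal.toReal_mono (ENNReal.mul_ne_top ENNReal.coe_ne_top (ρ.eval_ne_top f)) h
  rwa [ENNReal.toReal_mul, ENNReal.coe_toReal, toReal_enorm] at this

end BanachFunctionNorm

/-! ### The Riesz projection as an operator -/

theorem HasRieszProjection.hasCauchySingularIntegral {f g : UnitCirc → ℂ}
    (h : HasRieszProjection f g) :
    HasCauchySingularIntegral f (fun t => 2 * g t - f t) := by
  obtain ⟨u, hu, hg⟩ := h
  refine hu.congr_right ?_
  filter_upwards [hg] with t ht
  rw [ht]; ring

theorem HasCauchySingularIntegral.hasRieszProjection {f u g : UnitCirc → ℂ}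
    (h : HasCauchySingularIntegral f u) (hg : ∀ᵐ t ∂normMeas, 2 * g t = f t + u t) :
    HasRieszProjection f g :=
  ⟨u, h, hg.mono fun t ht => by rw [← ht]; ring⟩

theorem HasRieszProjection.ae_unique {f g g' : UnitCirc → ℂ} (h : HasRieszProjection f g)
    (h' : HasRieszProjection f g') : g =ᵐ[normMeas] g' := by
  filter_upwards [h.hasCauchySingularIntegral.ae_unique h'.hasCauchySingularIntegral] with t ht
  simpa using ht

theorem HasRieszProjection.congr {f f' g g' : UnitCirc → ℂ} (h : HasRieszProjection f g)
    (hf : f =ᵐ[normMeas] f') (hg : g =ᵐ[normMeas] g') : HasRieszProjection f' g' := by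
  obtain ⟨u, hu, hg2⟩ := h
  refine ⟨u, hu.congr hf, ?_⟩
  filter_upwards [hg2, hf, hg] with t h1 h2 h3
  rw [← h3, h1, h2]

namespace BanachFunctionNorm

variable (ρ : BanachFunctionNorm)

/-- `R` is the Riesz projection on the space, as a bounded operator. -/
def IsRiesz (R : ρ.space →L[ℂ] ρ.space) : Prop := ∀ f : ρ.space, HasRieszProjection f.1 (R f).1

theorem exists_isRiesz (hP : RieszProjectionBounded ρ) : ∃ R, ρ.IsRiesz R := by
  obtain ⟨C, hC⟩ := hP
  choose T hT hTb using hC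
  have hu : ∀ f (g : ρ.space), HasRieszProjection f.1 g.1 → T f = g :=
    fun f g hg => ext_ae ((hT f).ae_unique hg)
  let L : ρ.space →ₗ[ℂ] ρ.space :=
    { toFun := T
      map_add' := fun f g => by
        apply hu
        have h1 := (hT f).hasCauchySingularIntegral.add (ρ.integrable_coe f) (ρ.integrable_coe g)
          (hT g).hasCauchySingularIntegral
        refine (h1.congr (coe_add_ae f g).symm).hasRieszProjection ?_
        filter_upwards [coe_add_ae f g, coe_add_ae (T f) (T g)] with t h2 h3
        rw [h2, h3]; ring
      map_smul' := fun c f => by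
        apply hu
        have h1 := (hT f).hasCauchySingularIntegral.const_mul c
        refine (h1.congr (coe_smul_ae c f).symm).hasRieszProjection ?_
        filter_upwards [coe_smul_ae c f, coe_smul_ae c (T f)] with t h2 h3
        rw [RingHom.id_apply, h2, h3]; ring }
  exact ⟨L.mkContinuous C hTb, hT⟩

variable {ρ} {R : ρ.space →L[ℂ] ρ.space}

theorem IsRiesz.eq_of (hR : ρ.IsRiesz R) {f g : ρ.space} (h : HasRieszProjection f.1 g.1) :
    R f = g := ext_ae ((hR f).ae_unique h)

/-- The Riesz projection reproduces the functions of Hardy class. -/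
theorem IsRiesz.apply_hardy (hR : ρ.IsRiesz R) {f : ρ.space} (hf : f ∈ ρ.hardy) : R f = f := by
  have h := (hR f).hasCauchySingularIntegral.eq_self (ρ.integrable_coe f) hf
  apply ext_ae
  filter_upwards [h] with t ht
  linear_combination ht / 2

/-- Commutation of the Riesz projection with the multiplication by `z⁻¹`. -/
theorem IsRiesz.apply_shift (hR : ρ.IsRiesz R) (f : ρ.space) :
    R (ρ.shift (-1) f) = ρ.shift (-1) (R f - fourierCoeff f.1 0 • ρ.one) := by
  apply hR.eq_of
  have h := (hR f).hasCauchySingularIntegral.fourier_neg_one_mul (ρ.integrable_coe f)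
  refine (h.congr (ρ.shift_ae (-1) f).symm).hasRieszProjection ?_
  filter_upwards [ρ.shift_ae (-1) f, ρ.shift_ae (-1) (R f - fourierCoeff f.1 0 • ρ.one),
    coe_sub_ae (R f) (fourierCoeff f.1 0 • ρ.one), coe_smul_ae (fourierCoeff f.1 0) ρ.one,
    ρ.one_ae] with t h1 h2 h3 h4 h5
  rw [h1, h2, h3, h4, h5]
  ring

/-- On functions with finitely many negative frequencies, the Riesz projection cuts off the
negative frequencies. -/
theorem IsRiesz.fourierCoeff_apply (hR : ρ.IsRiesz R) (m : ℕ) (f : ρ.space)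
    (hf : ∀ n : ℤ, n < -m → fourierCoeff f.1 n = 0) (n : ℤ) :
    fourierCoeff (R f).1 n = if 0 ≤ n then fourierCoeff f.1 n else 0 := by
  induction m generalizing f n with
  | zero =>
    rw [hR.apply_hardy (show f ∈ ρ.hardy from fun n hn => hf n (by simpa using hn))]
    split_ifs with h
    · rfl
    · exact hf n (by push_cast; omega)
  | succ m ih =>
    set g := ρ.shift 1 f with hg
    have hfg : f = ρ.shift (-1) g := by rw [hg, shift_shift, neg_add_cancel, shift_zero]
    have hgc : ∀ n, fourierCoeff f.1 n = fourierCoeff g.1 (n + 1) := by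
      intro n; rw [hg, fourierCoeff_shift, add_sub_cancel_right]
    have hg0 : ∀ n : ℤ, n < -m → fourierCoeff g.1 n = 0 := by
      intro n hn
      have := hgc (n - 1)
      rw [sub_add_cancel] at this
      rw [← this]
      exact hf _ (by push_cast; omega)
    have hRf : R f = ρ.shift (-1) (R g - fourierCoeff g.1 0 • ρ.one) := by
      conv_lhs => rw [hfg]
      exact hR.apply_shift g
    rw [hRf, fourierCoeff_shift, fourierCoeff_coe_sub, fourierCoeff_coe_smul, fourierCoeff_one,
      ih g hg0, hgc n, sub_neg_eq_add]
    rcases lt_trichotomy n (-1) with h | h | h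
    · rw [if_neg (by omega), if_neg (by omega), if_neg (by omega)]; ring
    · subst h; simp
    · rw [if_pos (by omega), if_neg (by omega), if_pos (by omega)]; ring

end BanachFunctionNorm

/-! ### Bounded functions of small mean -/

theorem circleMap_eq_point (x : ℝ) : circleMap 0 1 x = point (x : UnitCirc) := by
  rw [point, AddCircle.toCircle_apply_mk, Circle.coe_exp, circleMap_zero]
  have : 2 * Real.pi / (2 * Real.pi) = 1 := div_self Real.two_pi_pos.ne'
  rw [this]; simp

/-- The mean value property on the unit disc. -/
theorem integral_comp_point {w : ℂ → ℂ} (hw : DiffContOnCl ℂ w (Metric.ball 0 1)) :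
    ∫ θ, w (point θ) ∂normMeas = w 0 := by
  have h1 : Real.circleAverage w 0 1 = w 0 :=
    DiffContOnCl.circleAverage (by simpa using hw)
  have h2 := fourierCoeff_eq_intervalIntegral (T := 2 * Real.pi) (fun θ => w (point θ)) 0 0
  have h3 : fourierCoeff (fun θ => w (point θ)) 0 = ∫ θ, w (point θ) ∂normMeas := by
    simp [fourierCoeff]
  rw [← h3, h2, ← h1, Real.circleAverage_def]
  simp only [neg_zero, fourier_zero, one_smul, zero_add, one_div, circleMap_eq_point]

theorem fourierCoeff_comp_point {w : ℂ → ℂ} (hw : DiffContOnCl ℂ w (Metric.ball 0 1)) {n : ℤ}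
    (hn : n < 0) : fourierCoeff (fun θ => w (point θ)) n = 0 := by
  obtain ⟨k, hk⟩ : ∃ k : ℕ, -n = (k + 1 : ℕ) := ⟨(-n - 1).toNat, by omega⟩
  have h1 : DiffContOnCl ℂ (fun z => z ^ (k + 1) * w z) (Metric.ball 0 1) :=
    (show Differentiable ℂ (fun z : ℂ => z ^ (k + 1)) by fun_prop).diffContOnCl.smul hw
  have h2 := integral_comp_point h1
  rw [fourierCoeff, hk]
  simp only [fourier_eq_zpow, zpow_natCast, smul_eq_mul]
  rw [h2]
  simp

theorem star_mem_trigPoly {p : C(UnitCirc, ℂ)} (hp : p ∈ trigPoly) : star p ∈ trigPoly := by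
  rw [trigPoly, ← fourierSubalgebra_coe] at hp ⊢
  exact (fourierSubalgebra (T := 2 * Real.pi)).star_mem' hp

theorem one_mem_trigPoly : (1 : C(UnitCirc, ℂ)) ∈ trigPoly := by
  have : (1 : C(UnitCirc, ℂ)) = fourier 0 := by ext θ; simp
  rw [this]; exact Submodule.subset_span ⟨0, rfl⟩

/-- Every trigonometric polynomial has the same real part as an analytic polynomial. -/
theorem exists_polynomial_re_eq {p : C(UnitCirc, ℂ)} (hp : p ∈ trigPoly) :
    ∃ q : Polynomial ℂ, (∀ θ, (q.eval (point θ)).re = (p θ).re) ∧ (q.eval 0).im = 0 := by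
  have key : ∀ c : ℂ, ∃ q : Polynomial ℂ, ∀ θ, (q.eval (point θ)).re = (c * p θ).re := by
    induction hp using Submodule.span_induction with
    | mem x hx =>
      obtain ⟨k, rfl⟩ := hx
      intro c
      obtain ⟨n, rfl | rfl⟩ := k.eq_nat_or_neg
      · refine ⟨Polynomial.C c * Polynomial.X ^ n, fun θ => ?_⟩
        rw [fourier_eq_zpow]; simp
      · refine ⟨Polynomial.C ((starRingEnd ℂ) c) * Polynomial.X ^ n, fun θ => ?_⟩
        rw [fourier_neg, fourier_eq_zpow, ← Complex.conj_re (c * _)]; simp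
    | zero => exact fun c => ⟨0, fun θ => by simp⟩
    | add x y _ _ hx hy =>
      intro c
      obtain ⟨q, hq⟩ := hx c
      obtain ⟨r, hr⟩ := hy c
      exact ⟨q + r, fun θ => by
        rw [Polynomial.eval_add, Complex.add_re, hq, hr, ContinuousMap.add_apply, mul_add,
          Complex.add_re]⟩
    | smul a x _ hx =>
      intro c
      obtain ⟨q, hq⟩ := hx (c * a)
      exact ⟨q, fun θ => by rw [hq, ContinuousMap.smul_apply, smul_eq_mul, mul_assoc]⟩
  obtain ⟨q, hq⟩ := key 1
  refine ⟨q - Polynomial.C (Complex.I * ((q.eval 0).im : ℂ)), fun θ => ?_, ?_⟩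
  · simp [hq θ]
  · simp

/-- Measurable functions with values in `[0, 1]` are approximated in `L¹` by trigonometric
polynomials with values in `[0, 1]`. -/
theorem exists_trigPoly_unitInterval {ψ : UnitCirc → ℝ} (hψ : AEStronglyMeasurable ψ normMeas)
    (h01 : ∀ᵐ t ∂normMeas, 0 ≤ ψ t ∧ ψ t ≤ 1) {η : ℝ} (hη : 0 < η) :
    ∃ p ∈ trigPoly, (∀ θ, p θ = ((p θ).re : ℂ) ∧ 0 ≤ (p θ).re ∧ (p θ).re ≤ 1) ∧
      ∫⁻ θ, ‖(p θ).re - ψ θ‖ₑ ∂normMeas ≤ ENNReal.ofReal η := by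
  have hψi : Integrable ψ normMeas := (memLp_top_of_bound hψ 1 (h01.mono fun t ht => by
    rw [Real.norm_of_nonneg ht.1]; exact ht.2)).integrable le_top
  obtain ⟨g, hg, hgi⟩ := hψi.exists_boundedContinuous_lintegral_sub_le
    (ε := ENNReal.ofReal (η / 2)) (by simpa using hη)
  set c : UnitCirc → ℝ := fun θ => max 0 (min 1 (g θ)) with hc
  have hc0 : ∀ θ, 0 ≤ c θ := fun θ => le_max_left _ _
  have hc1 : ∀ θ, c θ ≤ 1 := fun θ => max_le zero_le_one (min_le_left _ _)
  have hcc : Continuous c := continuous_const.max (continuous_const.min g.continuous)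
  set δ : ℝ := η / 4 with hδ
  have hδ0 : 0 < δ := by positivity
  obtain ⟨p, hp, hpc⟩ := exists_trigPoly_norm_sub_le
    (⟨fun θ => (c θ : ℂ), Complex.continuous_ofReal.comp hcc⟩ : C(UnitCirc, ℂ)) hδ0
  have hpre : ∀ θ, |c θ - (p θ).re| ≤ δ := by
    intro θ
    have h1 := (ContinuousMap.norm_coe_le_norm _ θ).trans hpc
    have h2 := (Complex.abs_re_le_norm _).trans h1
    simpa using h2
  set r : C(UnitCirc, ℂ) := ((1 + 2 * δ : ℝ) : ℂ)⁻¹ •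
    ((2 : ℂ)⁻¹ • (p + star p) + (δ : ℂ) • 1) with hr
  have hrv : ∀ θ, r θ = ((((p θ).re + δ) / (1 + 2 * δ) : ℝ) : ℂ) := by
    intro θ
    have : p θ + (starRingEnd ℂ) (p θ) = 2 * ((p θ).re : ℂ) := by
      rw [Complex.add_conj]; push_cast; ring
    simp only [hr, ContinuousMap.smul_apply, ContinuousMap.add_apply, ContinuousMap.star_apply,
      smul_eq_mul, ContinuousMap.one_apply, mul_one]
    rw [← starRingEnd_apply, this]
    push_cast
    field_simp
  have hrre : ∀ θ, (r θ).re = ((p θ).re + δ) / (1 + 2 * δ) := fun θ => by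
    rw [hrv, Complex.ofReal_re]
  refine ⟨r, ?_, fun θ => ⟨?_, ?_, ?_⟩, ?_⟩
  · exact Submodule.smul_mem _ _ (Submodule.add_mem _ (Submodule.smul_mem _ _
      (Submodule.add_mem _ hp (star_mem_trigPoly hp))) (Submodule.smul_mem _ _ one_mem_trigPoly))
  · rw [hrre, hrv]
  · rw [hrre]
    have := abs_le.1 (hpre θ)
    exact div_nonneg (by linarith [hc0 θ]) (by positivity)
  · rw [hrre, div_le_one (by positivity)]
    have := abs_le.1 (hpre θ)
    linarith [hc1 θ]
  · have hpt : ∀ᵐ θ ∂normMeas, ‖(r θ).re - ψ θ‖ₑ ≤ ENNReal.ofReal (η / 2) + ‖ψ θ - g θ‖ₑ := by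
      filter_upwards [h01] with θ hθ
      have h1 : |(r θ).re - c θ| ≤ η / 2 := by
        have h2 := abs_le.1 (hpre θ)
        have h3 := mul_nonneg hδ0.le (hc0 θ)
        have h4 := mul_nonneg hδ0.le (sub_nonneg.2 (hc1 θ))
        rw [hrre, abs_le, le_sub_iff_add_le, sub_le_iff_le_add, le_div_iff₀ (by positivity),
          div_le_iff₀ (by positivity)]
        constructor <;> nlinarith
      have h2 : |c θ - ψ θ| ≤ |ψ θ - g θ| := by
        rw [abs_sub_comm (ψ θ)]
        have h3 : c θ = max 0 (min 1 (g θ)) := rfl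
        have h4 : ψ θ = max 0 (min 1 (ψ θ)) := by rw [min_eq_right hθ.2, max_eq_right hθ.1]
        calc |c θ - ψ θ| = |max 0 (min 1 (g θ)) - max 0 (min 1 (ψ θ))| := by rw [← h3, ← h4]
          _ ≤ |min 1 (g θ) - min 1 (ψ θ)| := by
              simpa using abs_max_sub_max_le_max 0 (min 1 (g θ)) 0 (min 1 (ψ θ))
          _ ≤ |g θ - ψ θ| := by
              simpa using abs_min_sub_min_le_max 1 (g θ) 1 (ψ θ)
      rw [← ofReal_norm, ← ofReal_norm, ← ENNReal.ofReal_add (by positivity) (norm_nonneg _)]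
      refine ENNReal.ofReal_le_ofReal ?_
      rw [Real.norm_eq_abs, Real.norm_eq_abs]
      calc |(r θ).re - ψ θ| ≤ |(r θ).re - c θ| + |c θ - ψ θ| := abs_sub_le _ _ _
        _ ≤ _ := add_le_add h1 h2
    calc _ ≤ ∫⁻ θ, (ENNReal.ofReal (η / 2) + ‖ψ θ - g θ‖ₑ) ∂normMeas := lintegral_mono_ae hpt
      _ = ENNReal.ofReal (η / 2) + ∫⁻ θ, ‖ψ θ - g θ‖ₑ ∂normMeas := by
          rw [lintegral_add_left measurable_const]; simp
      _ ≤ ENNReal.ofReal (η / 2) + ENNReal.ofReal (η / 2) := add_le_add le_rfl hg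
      _ = ENNReal.ofReal η := by
          rw [← ENNReal.ofReal_add (by positivity) (by positivity), add_halves]

namespace BanachFunctionNorm

variable {ρ : BanachFunctionNorm} {R : ρ.space →L[ℂ] ρ.space}

/-- The Riesz projection recovers a function `w` analytic in the disc from its imaginary part,
up to the constant `w 0`; so a bounded imaginary part controls the norm of the real part. -/
theorem IsRiesz.norm_re_le (hR : ρ.IsRiesz R) {w : ℂ → ℂ}
    (hw : DiffContOnCl ℂ w (Metric.ball 0 1)) (hwc : Continuous fun θ => w (point θ))
    {c : ℝ} (hc : 0 ≤ c) (hw0 : w 0 = c) {B : ℝ} (hB : 0 ≤ B)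
    (him : ∀ θ, |(w (point θ)).im| ≤ B) {Y : ρ.space}
    (hY : Y.1 =ᵐ[normMeas] fun θ => ((w (point θ)).re : ℂ)) :
    ‖Y‖ ≤ ((2 * ‖R‖ + 1) * B + c) * ‖ρ.one‖ := by
  set wc : C(UnitCirc, ℂ) := ⟨fun θ => w (point θ), hwc⟩
  obtain ⟨V, hV⟩ := ρ.exists_of_bounded (φ := fun θ => w (point θ))
    hwc.aestronglyMeasurable (ae_of_all _ wc.norm_coe_le_norm)
  obtain ⟨U, hU⟩ := ρ.exists_of_bounded (φ := fun θ => ((w (point θ)).im : ℂ)) (M := B)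
    (Complex.continuous_ofReal.comp (Complex.continuous_im.comp hwc)).aestronglyMeasurable
    (ae_of_all _ fun θ => by
      rw [Complex.norm_real]; exact him θ)
  have hVh : V ∈ ρ.hardy := fun n hn => by
    rw [fourierCoeff_congr_ae hV]; exact fourierCoeff_comp_point hw hn
  have hV0 : fourierCoeff V.1 0 = c := by
    rw [fourierCoeff_congr_ae hV, ← hw0, ← integral_comp_point hw]; simp [fourierCoeff]
  have hSV := (hR V).hasCauchySingularIntegral
  rw [hR.apply_hardy hVh] at hSV
  have hVi := ρ.integrable_coe V
  have hSVc := hSV.conj hVi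
  have hVci : Integrable (fun t => (starRingEnd ℂ) (V.1 t)) normMeas :=
    (LinearIsometryEquiv.integrable_comp_iff (Complex.conjLIE)).2 hVi
  -- `Im w` is a combination of `w` and its conjugate, whose singular integrals are known
  have hSU := (hSV.const_mul (2 * Complex.I)⁻¹).add (hVi.const_mul _) (hVci.const_mul _)
    (hSVc.const_mul (-(2 * Complex.I)⁻¹))
  have hUe : U.1 =ᵐ[normMeas] fun t => (2 * Complex.I)⁻¹ * V.1 t
      + -(2 * Complex.I)⁻¹ * (starRingEnd ℂ) (V.1 t) := by
    filter_upwards [hU, hV] with t h1 h2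
    rw [h1, h2, Complex.im_eq_sub_conj]
    field_simp
    ring
  have hkey := (hSU.congr hUe.symm).ae_unique (hR U).hasCauchySingularIntegral
  have hYe : Y = (c : ℂ) • ρ.one + Complex.I • ((2 : ℂ) • R U - U) := by
    apply ext_ae
    filter_upwards [hY, hV, hkey, coe_add_ae ((c : ℂ) • ρ.one) (Complex.I • ((2 : ℂ) • R U - U)),
      coe_smul_ae (c : ℂ) ρ.one, ρ.one_ae, coe_smul_ae Complex.I ((2 : ℂ) • R U - U),
      coe_sub_ae ((2 : ℂ) • R U) U, coe_smul_ae (2 : ℂ) (R U)] with t h1 h2 h3 h4 h5 h6 h7 h8 h9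
    rw [h4, h5, h6, h7, h8, h9, ← h3, h1, h2, hV0, Complex.re_eq_add_conj]
    simp only [map_sub, map_mul, map_ofNat, Complex.conj_ofReal]
    have := Complex.I_ne_zero
    field_simp
    ring
  have hUn : ‖U‖ ≤ B * ‖ρ.one‖ := by
    refine norm_le_mul hB ?_
    filter_upwards [hU, ρ.one_ae] with t h1 h2
    rw [h1, h2, norm_one, mul_one, Complex.norm_real]
    exact him t
  rw [hYe]
  calc _ ≤ ‖(c : ℂ) • ρ.one‖ + ‖Complex.I • ((2 : ℂ) • R U - U)‖ := norm_add_le _ _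
    _ ≤ c * ‖ρ.one‖ + (2 * (‖R‖ * ‖U‖) + ‖U‖) := by
        refine add_le_add ?_ ?_
        · rw [norm_smul, Complex.norm_real, Real.norm_of_nonneg hc]
        · rw [norm_smul, Complex.norm_I, one_mul]
          refine (norm_sub_le _ _).trans (add_le_add ?_ le_rfl)
          rw [norm_smul, Complex.norm_ofNat]
          exact mul_le_mul_of_nonneg_left (R.le_opNorm U) (by norm_num)
    _ ≤ c * ‖ρ.one‖ + (2 * (‖R‖ * (B * ‖ρ.one‖)) + B * ‖ρ.one‖) := by gcongr
    _ = _ := by ring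

/-- The minimum principle for the real part, from the maximum principle for `exp (-q)`. -/
theorem re_nonneg_of_circle {q : Polynomial ℂ} (hq : ∀ θ, 0 ≤ (q.eval (point θ)).re) {z : ℂ}
    (hz : z ∈ Metric.closedBall (0 : ℂ) 1) : 0 ≤ (q.eval z).re := by
  have hd : DiffContOnCl ℂ (fun z => Complex.exp (-q.eval z)) (Metric.ball 0 1) :=
    (q.differentiable.neg.cexp).diffContOnCl
  have h := Complex.norm_le_of_forall_mem_frontier_norm_le Metric.isBounded_ball hd (C := 1)
    (fun z hz => by
      rw [frontier_ball _ one_ne_zero, mem_sphere_zero_iff_norm] at hz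
      have hpt : z = point (z.arg : UnitCirc) := by
        rw [← circleMap_eq_point, circleMap_zero]
        conv_lhs => rw [← Complex.norm_mul_exp_arg_mul_I z, hz]
      rw [Complex.norm_exp, Real.exp_le_one_iff, Complex.neg_re, hpt]
      linarith [hq (z.arg : UnitCirc)])
    (by rwa [closure_ball _ one_ne_zero])
  rw [Complex.norm_exp, Real.exp_le_one_iff, Complex.neg_re] at h
  linarith

/-- A trigonometric polynomial with values in `[0, 1]` and small mean `c` has a small norm: for its
analytic completion `q`, the function `log (1 + lam * q)` has a bounded imaginary part, while its
real part is at least `log (1 + lam)` times the polynomial. -/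
theorem IsRiesz.log_mul_norm_le_trigPoly (hR : ρ.IsRiesz R) {p : C(UnitCirc, ℂ)} (hp : p ∈ trigPoly)
    (h0 : ∀ θ, 0 ≤ (p θ).re) (h1 : ∀ θ, (p θ).re ≤ 1) {lam : ℝ} (hl : 0 < lam) {f : ρ.space}
    (hf : f.1 =ᵐ[normMeas] fun θ => ((p θ).re : ℂ)) :
    Real.log (1 + lam) * ‖f‖ ≤ ((2 * ‖R‖ + 1) * (Real.pi / 2)
      + Real.log (1 + lam * ∫ θ, (p θ).re ∂normMeas)) * ‖ρ.one‖ := by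
  obtain ⟨q, hqp, hq0⟩ := exists_polynomial_re_eq hp
  have hqc : Continuous fun θ => q.eval (point θ) := q.continuous.comp continuous_point
  have hqre : ∀ θ, 0 ≤ (q.eval (point θ)).re := fun θ => by rw [hqp]; exact h0 θ
  set c : ℝ := (q.eval 0).re with hc
  have hqi : Integrable (fun θ => q.eval (point θ)) normMeas :=
    integrable_continuousMap ⟨_, hqc⟩
  have hcint : c = ∫ θ, (p θ).re ∂normMeas := by
    have h2 := integral_comp_point q.differentiable.diffContOnCl
    have h3 := integral_re hqi
    have h4 : ∫ θ, (q.eval (point θ)).re ∂normMeas = c := by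
      rw [hc, ← h2]; exact h3
    rw [← h4]
    exact integral_congr_ae (ae_of_all _ fun θ => hqp θ)
  have hc0 : 0 ≤ c := re_nonneg_of_circle hqre (by simp)
  have hpos : ∀ z ∈ Metric.closedBall (0 : ℂ) 1, 0 < (1 + (lam : ℂ) * q.eval z).re := by
    intro z hz
    have := re_nonneg_of_circle hqre hz
    simp only [Complex.add_re, Complex.one_re, Complex.re_ofReal_mul]
    positivity
  set w : ℂ → ℂ := fun z => Complex.log (1 + (lam : ℂ) * q.eval z) with hw
  have hmem : ∀ θ, point θ ∈ Metric.closedBall (0 : ℂ) 1 := fun θ => by simp [norm_point]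
  have hwd : DiffContOnCl ℂ w (Metric.ball 0 1) := by
    apply DifferentiableOn.diffContOnCl
    rw [closure_ball _ one_ne_zero]
    intro z hz
    refine DifferentiableAt.differentiableWithinAt (DifferentiableAt.clog ?_ ?_)
    · exact (differentiableAt_const _).add ((differentiableAt_const _).mul q.differentiableAt)
    · exact Or.inl (hpos z hz)
  have hwc : Continuous fun θ => w (point θ) := by
    refine Continuous.clog (continuous_const.add (continuous_const.mul hqc)) fun θ => ?_
    exact Or.inl (hpos _ (hmem θ))
  have hw0 : w 0 = (Real.log (1 + lam * c) : ℝ) := by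
    have : q.eval 0 = (c : ℂ) := Complex.ext rfl (by simpa using hq0)
    rw [hw]
    simp only [this]
    rw [Complex.ofReal_log (by positivity)]
    push_cast
    rfl
  have him : ∀ θ, |(w (point θ)).im| ≤ Real.pi / 2 := by
    intro θ
    rw [hw]
    simp only [Complex.log_im]
    exact Complex.abs_arg_le_pi_div_two_iff.2 (hpos _ (hmem θ)).le
  obtain ⟨Y, hY⟩ := ρ.exists_of_bounded (φ := fun θ => ((w (point θ)).re : ℂ))
    (Complex.continuous_ofReal.comp (Complex.continuous_re.comp hwc)).aestronglyMeasurable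
    (ae_of_all _ (ContinuousMap.norm_coe_le_norm
      ⟨_, Complex.continuous_ofReal.comp (Complex.continuous_re.comp hwc)⟩))
  have hYn := hR.norm_re_le hwd hwc (Real.log_nonneg (by nlinarith)) hw0
    (by positivity) him hY
  rw [hcint] at hYn
  refine le_trans ?_ hYn
  have hl0 : 0 ≤ Real.log (1 + lam) := Real.log_nonneg (by linarith)
  have hfY : ‖(Real.log (1 + lam) : ℂ) • f‖ ≤ 1 * ‖Y‖ := by
    refine norm_le_mul zero_le_one ?_
    filter_upwards [hf, hY, coe_smul_ae (Real.log (1 + lam) : ℂ) f] with θ h2 h3 h4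
    rw [h4, h2, h3, one_mul, norm_mul, Complex.norm_real, Complex.norm_real, Complex.norm_real,
      Real.norm_of_nonneg hl0, Real.norm_of_nonneg (h0 θ)]
    refine le_trans ?_ (Real.le_norm_self _)
    rw [hw]
    simp only [Complex.log_re]
    set x := (p θ).re with hx
    -- Bernoulli's inequality
    have hb : (1 + lam) ^ x ≤ 1 + x * lam :=
      rpow_one_add_le_one_add_mul_self (by linarith) (h0 θ) (h1 θ)
    calc Real.log (1 + lam) * x = Real.log ((1 + lam) ^ x) := by
          rw [Real.log_rpow (by positivity), mul_comm]
      _ ≤ Real.log (1 + x * lam) := Real.log_le_log (by positivity) hb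
      _ ≤ _ := by
          refine Real.log_le_log (by have := h0 θ; positivity) ?_
          refine le_trans (le_of_eq ?_) (Complex.re_le_norm _)
          simp only [Complex.add_re, Complex.one_re, Complex.re_ofReal_mul, hqp θ]
          ring
  rwa [norm_smul, Complex.norm_real, Real.norm_of_nonneg hl0, one_mul] at hfY

/-- The estimate for trigonometric polynomials with values in `[0, 1]` extends to all measurable
functions bounded by one, by the Fatou property. -/
theorem IsRiesz.log_mul_norm_le (hR : ρ.IsRiesz R) {f : ρ.space}
    (h1 : ∀ᵐ t ∂normMeas, ‖f.1 t‖ ≤ 1) {lam : ℝ} (hl : 0 < lam) :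
    Real.log (1 + lam) * ‖f‖ ≤ ((2 * ‖R‖ + 1) * (Real.pi / 2)
      + Real.log (1 + lam * ∫ θ, ‖f.1 θ‖ ∂normMeas)) * ‖ρ.one‖ := by
  have hfi := (ρ.integrable_coe f).norm
  choose p hp hp01 hpf using fun j : ℕ => exists_trigPoly_unitInterval (η := 1 / ((j : ℝ) + 1))
    hfi.1 (h1.mono fun t ht => ⟨norm_nonneg _, ht⟩) (by positivity)
  have hpc : ∀ j, Continuous fun θ => (p j θ).re := fun j =>
    Complex.continuous_re.comp (p j).continuous
  have hlim0 : Tendsto (fun j : ℕ => ENNReal.ofReal (1 / ((j : ℝ) + 1))) atTop (𝓝 0) := by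
    have := ENNReal.tendsto_ofReal (tendsto_one_div_add_atTop_nhds_zero_nat (𝕜 := ℝ))
    simpa using this
  have hL1 : Tendsto (fun j => ∫⁻ θ, ‖(p j θ).re - ‖f.1 θ‖‖ₑ ∂normMeas) atTop (𝓝 0) :=
    tendsto_of_tendsto_of_tendsto_of_le_of_le tendsto_const_nhds hlim0 (fun _ => zero_le) hpf
  have hmeas : TendstoInMeasure normMeas (fun j θ => (p j θ).re) atTop (fun θ => ‖f.1 θ‖) := by
    refine tendstoInMeasure_of_tendsto_eLpNorm one_ne_zero
      (fun j => (hpc j).aestronglyMeasurable) hfi.1 ?_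
    refine hL1.congr fun j => ?_
    rw [eLpNorm_one_eq_lintegral_enorm]
    rfl
  obtain ⟨ns, hns, hae⟩ := hmeas.exists_seq_tendsto_ae
  have hint : Tendsto (fun j => ∫ θ, (p (ns j) θ).re ∂normMeas) atTop
      (𝓝 (∫ θ, ‖f.1 θ‖ ∂normMeas)) :=
    tendsto_integral_of_L1 _ hfi.1
      (Eventually.of_forall fun j => (integrable_continuousMap (p (ns j))).re)
      (hL1.comp hns.tendsto_atTop)
  choose P hP using fun j => ρ.exists_of_bounded (φ := fun θ => ((p (ns j) θ).re : ℂ)) (M := 1)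
    (Complex.continuous_ofReal.comp (hpc _)).aestronglyMeasurable
    (ae_of_all _ fun θ => by
      rw [Complex.norm_real, Real.norm_of_nonneg (hp01 _ θ).2.1]; exact (hp01 _ θ).2.2)
  set B : ℝ → ℝ := fun x => ((2 * ‖R‖ + 1) * (Real.pi / 2) + Real.log (1 + lam * x)) * ‖ρ.one‖
    with hB
  have hPb : ∀ j, Real.log (1 + lam) * ‖P j‖ ≤ B (∫ θ, (p (ns j) θ).re ∂normMeas) := fun j =>
    hR.log_mul_norm_le_trigPoly (hp _) (fun θ => (hp01 _ θ).2.1) (fun θ => (hp01 _ θ).2.2) hl (hP j)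
  have hBc : Tendsto (fun j => B (∫ θ, (p (ns j) θ).re ∂normMeas)) atTop
      (𝓝 (B (∫ θ, ‖f.1 θ‖ ∂normMeas))) := by
    have hn : 0 ≤ ∫ θ, ‖f.1 θ‖ ∂normMeas := integral_nonneg fun _ => norm_nonneg _
    refine Tendsto.mul_const _ (Tendsto.const_add _ ?_)
    refine ((Real.continuousAt_log (by positivity)).tendsto).comp ?_
    exact (hint.const_mul lam).const_add 1
  -- the lower envelopes of the tails increase to `|f|`
  set F : ℕ → UnitCirc → ℝ≥0∞ := fun k θ => ⨅ j, ‖(P (j + k)).1 θ‖ₑ with hF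
  have hFm : ∀ k, AEMeasurable (F k) normMeas := fun k =>
    AEMeasurable.iInf fun j => aemeasurable_enorm _
  have hfat := ρ.fatou F (fun θ => ‖f.1 θ‖ₑ) hFm (aemeasurable_enorm _) (by
    filter_upwards [hae, ae_all_iff.2 hP] with θ h2 h3
    have hmono : Monotone fun k => F k θ := by
      intro k l hkl
      refine le_iInf fun j => ?_
      refine (iInf_le _ (j + (l - k))).trans (le_of_eq ?_)
      congr 4
      omega
    refine ⟨hmono, ?_⟩
    have h4 : Tendsto (fun j => ‖(P j).1 θ‖ₑ) atTop (𝓝 ‖f.1 θ‖ₑ) := by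
      have h5 := h2.enorm
      rw [enorm_norm] at h5
      refine h5.congr fun j => ?_
      rw [h3 j, ← ofReal_norm, ← ofReal_norm, Complex.norm_real]
    have h6 := tendsto_atTop_iSup hmono
    have h7 : ⨆ k, F k θ = ‖f.1 θ‖ₑ := liminf_eq_iSup_iInf_of_nat'.symm.trans h4.liminf_eq
    rwa [h7] at h6)
  have hFP : ∀ k, ρ.rho (F k) ≤ ρ.eval (P k).1 := fun k => by
    refine ρ.mono _ _ (aemeasurable_enorm _) (hFm k) (ae_of_all _ fun θ => ?_)
    exact (iInf_le _ 0).trans (le_of_eq (by rw [zero_add]))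
  have hl0 : 0 ≤ Real.log (1 + lam) := Real.log_nonneg (by linarith)
  have hlim : Tendsto (fun k => Real.log (1 + lam) * (ρ.rho (F k)).toReal) atTop
      (𝓝 (Real.log (1 + lam) * ‖f‖)) :=
    ((ENNReal.tendsto_toReal (ρ.eval_ne_top f)).comp hfat.2).const_mul _
  refine le_of_tendsto_of_tendsto' hlim hBc fun k => ?_
  refine le_trans (mul_le_mul_of_nonneg_left ?_ hl0) (hPb k)
  exact ENNReal.toReal_mono (ρ.eval_ne_top _) (hFP k)

/-- If the Riesz projection is bounded, then functions bounded by one with a small mean have a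
small norm. -/
theorem IsRiesz.exists_norm_le_of_integral_le (hR : ρ.IsRiesz R) {η : ℝ} (hη : 0 < η) :
    ∃ δ > 0, ∀ f : ρ.space, (∀ᵐ t ∂normMeas, ‖f.1 t‖ ≤ 1) →
      ∫ θ, ‖f.1 θ‖ ∂normMeas ≤ δ → ‖f‖ ≤ η := by
  -- for a mean of at most `lam⁻¹` the right-hand side of `IsRiesz.log_mul_norm_le` is at most `A`
  set A : ℝ := ((2 * ‖R‖ + 1) * (Real.pi / 2) + Real.log 2) * ‖ρ.one‖ with hA
  have hlog : Tendsto (fun x : ℝ => Real.log (1 + x)) atTop atTop :=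
    Real.tendsto_log_atTop.comp (tendsto_atTop_add_const_left _ _ tendsto_id)
  obtain ⟨lam, hl, hlA⟩ := ((eventually_gt_atTop (0 : ℝ)).and
    (hlog.eventually_ge_atTop (A / η))).exists
  refine ⟨lam⁻¹, by positivity, fun f hf hfi => ?_⟩
  have h := hR.log_mul_norm_le hf hl
  have hn : 0 ≤ ∫ θ, ‖f.1 θ‖ ∂normMeas := integral_nonneg fun _ => norm_nonneg _
  have h2 : Real.log (1 + lam * ∫ θ, ‖f.1 θ‖ ∂normMeas) ≤ Real.log 2 := by
    refine Real.log_le_log (by positivity) ?_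
    have := mul_le_mul_of_nonneg_left hfi hl.le
    rw [mul_inv_cancel₀ hl.ne'] at this
    linarith
  have h3 : Real.log (1 + lam) * ‖f‖ ≤ A := by
    refine h.trans ?_
    rw [hA]
    gcongr
  have hlp : 0 < Real.log (1 + lam) := Real.log_pos (by linarith)
  have h4 : A ≤ Real.log (1 + lam) * η := by rwa [div_le_iff₀ hη] at hlA
  exact le_of_mul_le_mul_left (h3.trans h4) hlp

/-- The norm density of the trigonometric polynomials among the functions with values in
`[0, 1]`. -/
theorem IsRiesz.exists_trigPoly_norm_sub_le (hR : ρ.IsRiesz R) {ψ : UnitCirc → ℝ}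
    (hψ : AEStronglyMeasurable ψ normMeas) (h01 : ∀ᵐ t ∂normMeas, 0 ≤ ψ t ∧ ψ t ≤ 1)
    {f : ρ.space} (hf : f.1 =ᵐ[normMeas] fun t => (ψ t : ℂ)) {η : ℝ} (hη : 0 < η) :
    ∃ p ∈ trigPoly, ∃ P : ρ.space, P.1 =ᵐ[normMeas] p ∧ ‖f - P‖ ≤ η := by
  obtain ⟨δ, hδ, hδη⟩ := hR.exists_norm_le_of_integral_le hη
  obtain ⟨p, hp, hp01, hpψ⟩ := exists_trigPoly_unitInterval hψ h01 hδ
  obtain ⟨P, hP⟩ := ρ.exists_of_bounded p.continuous.aestronglyMeasurable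
    (ae_of_all _ p.norm_coe_le_norm)
  refine ⟨p, hp, P, hP, hδη _ ?_ ?_⟩
  · filter_upwards [hf, hP, coe_sub_ae f P, h01] with t h1 h2 h3 h4
    obtain ⟨h5, h6, h7⟩ := hp01 t
    rw [h3, h1, h2, h5, ← Complex.ofReal_sub, Complex.norm_real, Real.norm_eq_abs, abs_le]
    constructor <;> linarith [h4.1, h4.2]
  · rw [integral_norm_eq_lintegral_enorm (AEEqFun.aestronglyMeasurable _)]
    refine ENNReal.toReal_le_of_le_ofReal hδ.le (le_trans (le_of_eq ?_) hpψ)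
    refine lintegral_congr_ae ?_
    filter_upwards [hf, hP, coe_sub_ae f P] with t h1 h2 h3
    rw [h3, h1, h2, (hp01 t).1, ← Complex.ofReal_sub, ← ofReal_norm, ← ofReal_norm,
      Complex.norm_real, norm_sub_rev, Complex.ofReal_re]

/-! ### Averages of shifts -/

theorem coe_sum_ae {ι : Type*} (s : Finset ι) (f : ι → ρ.space) :
    (∑ i ∈ s, f i).1 =ᵐ[normMeas] fun t => ∑ i ∈ s, (f i).1 t := by
  classical
  induction s using Finset.induction_on with
  | empty =>
    filter_upwards [AEEqFun.coeFn_zero (α := UnitCirc) (β := ℂ) (μ := normMeas)] with t ht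
    simp [ht]
  | insert a s ha ih =>
    rw [Finset.sum_insert ha]
    filter_upwards [coe_add_ae (f a) (∑ i ∈ s, f i), ih] with t h1 h2
    rw [h1, h2, Finset.sum_insert ha]

theorem integral_fourier_normMeas (n : ℤ) :
    ∫ t, fourier n t ∂normMeas = if n = 0 then 1 else 0 := by
  have h := congrFun (fourierCoeff_fourier (T := 2 * Real.pi) n) 0
  rw [Pi.single_apply] at h
  simp only [fourierCoeff, neg_zero, fourier_zero, one_smul] at h
  rw [h]
  simp [eq_comm]

theorem integral_norm_sq_average {φ : ℕ → ℕ} (hφ : StrictMono φ) {N : ℕ} (hN : 0 < N) :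
    ∫ t, ‖(N : ℂ)⁻¹ * ∑ i ∈ Finset.range N, fourier (φ i : ℤ) t‖ ^ 2 ∂normMeas = (N : ℝ)⁻¹ := by
  have hN0 : (N : ℂ) ≠ 0 := by exact_mod_cast hN.ne'
  have h1 : ∀ t : UnitCirc, ((‖(N : ℂ)⁻¹ * ∑ i ∈ Finset.range N, fourier (φ i : ℤ) t‖ ^ 2 : ℝ) : ℂ)
      = ∑ i ∈ Finset.range N, ∑ j ∈ Finset.range N,
        ((N : ℂ)⁻¹ * (N : ℂ)⁻¹) * fourier ((φ i : ℤ) + -(φ j : ℤ)) t := by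
    intro t
    rw [Complex.ofReal_pow, ← Complex.mul_conj', map_mul, map_sum, mul_mul_mul_comm,
      Finset.sum_mul_sum, Finset.mul_sum, map_inv₀, map_natCast]
    refine Finset.sum_congr rfl fun i _ => ?_
    rw [Finset.mul_sum]
    refine Finset.sum_congr rfl fun j _ => ?_
    rw [fourier_add, fourier_neg]
  have hi : ∀ i j, Integrable (fun t : UnitCirc => ((N : ℂ)⁻¹ * (N : ℂ)⁻¹) *
      fourier ((φ i : ℤ) + -(φ j : ℤ)) t) normMeas := fun i j =>
    (integrable_continuousMap (fourier _)).const_mul _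
  have h2 : ∀ i ∈ Finset.range N, ∫ t : UnitCirc, ∑ j ∈ Finset.range N, ((N : ℂ)⁻¹ * (N : ℂ)⁻¹) *
      fourier ((φ i : ℤ) + -(φ j : ℤ)) t ∂normMeas = (N : ℂ)⁻¹ * (N : ℂ)⁻¹ := by
    intro i hi'
    rw [integral_finsetSum _ fun j _ => hi i j, Finset.sum_eq_single i]
    · rw [integral_const_mul, integral_fourier_normMeas, if_pos (by ring), mul_one]
    · intro j _ hji
      rw [integral_const_mul, integral_fourier_normMeas, if_neg, mul_zero]
      intro h
      exact hji (hφ.injective (by omega))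
    · exact fun h => absurd hi' h
  rw [← Complex.ofReal_inj, ← integral_complex_ofReal, integral_congr_ae (ae_of_all _ h1),
    integral_finsetSum _ fun i _ => integrable_finsetSum _ fun j _ => hi i j,
    Finset.sum_congr rfl h2, Finset.sum_const, Finset.card_range, nsmul_eq_mul, ← mul_assoc,
    mul_inv_cancel₀ hN0, one_mul, Complex.ofReal_inv, Complex.ofReal_natCast]

/-- The averages of distinct characters are small in mean: their mean square is `1 / N`. -/
theorem integral_norm_average_le {φ : ℕ → ℕ} (hφ : StrictMono φ) {N : ℕ} (hN : 0 < N) {s : ℝ}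
    (hs : 0 < s) :
    ∫ t, ‖(N : ℂ)⁻¹ * ∑ i ∈ Finset.range N, fourier (φ i : ℤ) t‖ ∂normMeas ≤
      (s + (s * N)⁻¹) / 2 := by
  have hsq := integral_norm_sq_average hφ hN
  set q : UnitCirc → ℂ := fun t => (N : ℂ)⁻¹ * ∑ i ∈ Finset.range N, fourier (φ i : ℤ) t with hq
  have hqc : Continuous q :=
    continuous_const.mul (continuous_finsetSum _ fun i _ => (fourier (φ i : ℤ)).continuous)
  have hsqi : Integrable (fun t => ‖q t‖ ^ 2) normMeas :=
    (hqc.norm.pow 2).integrable_of_hasCompactSupport (HasCompactSupport.of_compactSpace _)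
  have hqi : Integrable (fun t => ‖q t‖) normMeas :=
    hqc.norm.integrable_of_hasCompactSupport (HasCompactSupport.of_compactSpace _)
  calc ∫ t, ‖q t‖ ∂normMeas ≤ ∫ t, (s / 2 + (2 * s)⁻¹ * ‖q t‖ ^ 2) ∂normMeas := by
        refine integral_mono hqi ((integrable_const _).add (hsqi.const_mul _)) fun t => ?_
        have h1 : s / 2 + (2 * s)⁻¹ * ‖q t‖ ^ 2 - ‖q t‖ = (2 * s)⁻¹ * (s - ‖q t‖) ^ 2 := by
          field_simp; ring
        have h2 : 0 ≤ (2 * s)⁻¹ * (s - ‖q t‖) ^ 2 := by positivity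
        simp only
        linarith
    _ = s / 2 + (2 * s)⁻¹ * (N : ℝ)⁻¹ := by
        rw [integral_add (integrable_const _) (hsqi.const_mul _), integral_const_mul, hsq]
        simp
    _ = _ := by
        have : (N : ℝ) ≠ 0 := by exact_mod_cast hN.ne'
        field_simp

/-- The averages of the shifts of a bounded function tend to zero in norm, along every
subsequence of the shifts. -/
theorem IsRiesz.tendsto_average_shift (hR : ρ.IsRiesz R) {φ : ℕ → ℕ} (hφ : StrictMono φ)
    {v : ρ.space} {M : ℝ} (hv : ∀ᵐ t ∂normMeas, ‖v.1 t‖ ≤ M) :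
    Tendsto (fun N : ℕ => (N : ℂ)⁻¹ • ∑ i ∈ Finset.range N, ρ.shift (φ i) v) atTop (𝓝 0) := by
  have hM : 0 ≤ M := by
    obtain ⟨t, ht⟩ := hv.exists
    exact (norm_nonneg _).trans ht
  have hav : ∀ (N : ℕ) (u : ρ.space),
      ((N : ℂ)⁻¹ • ∑ i ∈ Finset.range N, ρ.shift (φ i) u).1 =ᵐ[normMeas]
        fun t => ((N : ℂ)⁻¹ * ∑ i ∈ Finset.range N, fourier (φ i : ℤ) t) * u.1 t := by
    intro N u
    filter_upwards [coe_smul_ae (N : ℂ)⁻¹ (∑ i ∈ Finset.range N, ρ.shift (φ i) u),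
      coe_sum_ae (Finset.range N) fun i => ρ.shift (φ i) u,
      ae_all_iff.2 fun i => ρ.shift_ae (φ i) u] with t h1 h2 h3
    rw [h1, h2, mul_assoc, Finset.sum_mul]
    congr 1
    exact Finset.sum_congr rfl fun i _ => h3 i
  have hone : Tendsto (fun N : ℕ => (N : ℂ)⁻¹ • ∑ i ∈ Finset.range N, ρ.shift (φ i) ρ.one)
      atTop (𝓝 0) := by
    rw [Metric.tendsto_atTop]
    intro η hη
    obtain ⟨δ, hδ, hδη⟩ := hR.exists_norm_le_of_integral_le (half_pos hη)
    obtain ⟨N₀, hN₀⟩ := exists_nat_gt ((δ * δ)⁻¹)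
    refine ⟨N₀ + 1, fun N hN => ?_⟩
    have hNpos : 0 < N := by omega
    have hNr : (0 : ℝ) < N := by exact_mod_cast hNpos
    rw [dist_zero_right]
    have hval : ((N : ℂ)⁻¹ • ∑ i ∈ Finset.range N, ρ.shift (φ i) ρ.one).1 =ᵐ[normMeas]
        fun t => (N : ℂ)⁻¹ * ∑ i ∈ Finset.range N, fourier (φ i : ℤ) t := by
      filter_upwards [hav N ρ.one, ρ.one_ae] with t h1 h2
      rw [h1, h2, mul_one]
    refine lt_of_le_of_lt (hδη _ ?_ ?_) (half_lt_self hη)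
    · filter_upwards [hval] with t h1
      rw [h1, norm_mul, norm_inv, Complex.norm_natCast, inv_mul_le_iff₀ hNr, mul_one]
      refine (norm_sum_le _ _).trans (le_of_eq ?_)
      simp only [norm_fourier_apply]
      simp
    · rw [integral_congr_ae (hval.mono fun t ht => by rw [ht])]
      refine (integral_norm_average_le hφ hNpos hδ).trans ?_
      have h1 : (δ * N)⁻¹ ≤ δ := by
        rw [inv_le_iff_one_le_mul₀ (by positivity)]
        have h2 : (δ * δ)⁻¹ ≤ N := hN₀.le.trans (by exact_mod_cast (by omega : N₀ ≤ N))
        rw [inv_le_iff_one_le_mul₀ (by positivity)] at h2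
        linarith
      linarith
  rw [tendsto_zero_iff_norm_tendsto_zero] at hone ⊢
  have h2 := hone.const_mul M
  rw [mul_zero] at h2
  refine squeeze_zero (fun _ => norm_nonneg _) (fun N => ?_) h2
  refine norm_le_mul hM ?_
  filter_upwards [hav N v, hav N ρ.one, hv, ρ.one_ae] with t h1 h2 h3 h4
  rw [h1, h2, h4, mul_one, norm_mul, mul_comm]
  exact mul_le_mul_of_nonneg_right h3 (norm_nonneg _)

end BanachFunctionNorm

/-! ### The essential norm -/

section EssNorm

variable {E : Type*} [NormedAddCommGroup E] [NormedSpace ℂ E]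

theorem essNorm_le_norm_sub {A K : E →L[ℂ] E} (hK : IsCompactOperator K) :
    essNorm A ≤ ‖A - K‖ :=
  csInf_le ⟨0, by rintro r ⟨K, -, rfl⟩; exact norm_nonneg _⟩ ⟨K, hK, rfl⟩

theorem le_essNorm {A : E →L[ℂ] E} {c : ℝ}
    (h : ∀ K : E →L[ℂ] E, IsCompactOperator K → c ≤ ‖A - K‖) : c ≤ essNorm A :=
  le_csInf ⟨_, 0, isCompactOperator_zero, rfl⟩ (by rintro r ⟨K, hK, rfl⟩; exact h K hK)

theorem essNorm_nonneg (A : E →L[ℂ] E) : 0 ≤ essNorm A := le_essNorm fun _ _ => norm_nonneg _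

theorem essNorm_le_norm (A : E →L[ℂ] E) : essNorm A ≤ ‖A‖ := by
  simpa using essNorm_le_norm_sub (A := A) (K := 0) isCompactOperator_zero

theorem exists_norm_sub_lt_of_essNorm_lt {A : E →L[ℂ] E} {c : ℝ} (h : essNorm A < c) :
    ∃ K : E →L[ℂ] E, IsCompactOperator K ∧ ‖A - K‖ < c := by
  by_contra! h2
  exact absurd (le_essNorm h2) (not_le.2 h)

theorem essNorm_le_add_norm_sub (A B : E →L[ℂ] E) : essNorm A ≤ essNorm B + ‖A - B‖ := by
  rw [← sub_le_iff_le_add]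
  refine le_essNorm fun K hK => ?_
  rw [sub_le_iff_le_add]
  refine (essNorm_le_norm_sub (A := A) hK).trans ?_
  have : A - K = (B - K) + (A - B) := by abel
  rw [this]
  exact norm_add_le _ _

theorem essNorm_comp_le (A B : E →L[ℂ] E) : essNorm (A ∘L B) ≤ essNorm A * essNorm B := by
  have key : ∀ K L : E →L[ℂ] E, IsCompactOperator K → IsCompactOperator L →
      essNorm (A ∘L B) ≤ ‖A - K‖ * ‖B - L‖ := by
    intro K L hK hL
    have h1 : IsCompactOperator (A ∘L L + K ∘L (B - L)) :=
      (hL.clm_comp A).add (hK.comp_clm (B - L))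
    have h2 : A ∘L B - (A ∘L L + K ∘L (B - L)) = (A - K) ∘L (B - L) := by
      ext x; simp only [sub_apply, add_apply,
        ContinuousLinearMap.comp_apply, map_sub]; abel
    refine (essNorm_le_norm_sub h1).trans ?_
    rw [h2]
    exact ContinuousLinearMap.opNorm_comp_le _ _
  have hlim : Tendsto (fun η : ℝ => (essNorm A + η) * (essNorm B + η)) (𝓝[>] 0)
      (𝓝 (essNorm A * essNorm B)) := by
    have : ContinuousAt (fun η : ℝ => (essNorm A + η) * (essNorm B + η)) 0 := by fun_prop
    have h2 := this.tendsto
    simp only [add_zero] at h2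
    exact h2.mono_left nhdsWithin_le_nhds
  refine ge_of_tendsto hlim ?_
  filter_upwards [self_mem_nhdsWithin] with η hη
  have hη : 0 < η := hη
  obtain ⟨K, hK, hK2⟩ := exists_norm_sub_lt_of_essNorm_lt (lt_add_of_pos_right (essNorm A) hη)
  obtain ⟨L, hL, hL2⟩ := exists_norm_sub_lt_of_essNorm_lt (lt_add_of_pos_right (essNorm B) hη)
  exact (key K L hK hL).trans (mul_le_mul hK2.le hL2.le (norm_nonneg _)
    (add_nonneg (essNorm_nonneg A) hη.le))

end EssNorm

/-! ### Symbols with finitely many negative frequencies -/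

/-- The Fourier coefficients of the symbol `a` vanish below `-m`; equivalently, `z ^ m a` is in
`H^∞`. -/
def SpectrumBelow (m : ℕ) (a : Lp ℂ ∞ normMeas) : Prop := ∀ n : ℤ, n < -m → fourierCoeff a n = 0

theorem norm_Linfty_le_of_ae {a : Lp ℂ ∞ normMeas} {c : ℝ} (hc : 0 ≤ c)
    (h : ∀ᵐ t ∂normMeas, ‖a t‖ ≤ c) : ‖a‖ ≤ c := by
  simpa using Lp.norm_le_of_ae_bound hc h

/-- Multiplication by `z` raises the lowest frequency of a symbol by one. -/
theorem exists_shift_symbol {m : ℕ} {b : Lp ℂ ∞ normMeas} (hb : SpectrumBelow (m + 1) b) :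
    ∃ b' : Lp ℂ ∞ normMeas, SpectrumBelow m b' ∧ ‖b'‖ ≤ ‖b‖ ∧
      b' =ᵐ[normMeas] fun t => fourier 1 t * b t := by
  have hm : MemLp (fun t => fourier 1 t * b t) ∞ normMeas :=
    memLp_top_of_bound ((fourier 1).continuous.aestronglyMeasurable.mul
      (Lp.aestronglyMeasurable b)) ‖b‖ (by
        filter_upwards [ae_norm_le_norm_Linfty b] with t ht
        rwa [norm_mul, norm_fourier_apply, one_mul])
  refine ⟨hm.toLp _, fun n hn => ?_, ?_, hm.coeFn_toLp⟩
  · rw [fourierCoeff_congr_ae hm.coeFn_toLp, fourierCoeff_fourier_mul]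
    exact hb _ (by push_cast; omega)
  · refine norm_Linfty_le_of_ae (norm_nonneg b) ?_
    filter_upwards [hm.coeFn_toLp, ae_norm_le_norm_Linfty b] with t h1 h2
    rwa [h1, norm_mul, norm_fourier_apply, one_mul]

/-- Symbols with finitely many negative frequencies are dense in `C + H^∞`. -/
theorem exists_spectrumBelow_norm_sub_le {a : Lp ℂ ∞ normMeas} (ha : a ∈ cPlusHInfty) {η : ℝ}
    (hη : 0 < η) : ∃ (m : ℕ) (b : Lp ℂ ∞ normMeas), SpectrumBelow m b ∧ ‖a - b‖ ≤ η := by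
  obtain ⟨g, h, hh, rfl⟩ := ha
  obtain ⟨p, hp, hgp⟩ := exists_trigPoly_norm_sub_le g hη
  obtain ⟨m, hm⟩ := fourierCoeff_trigPoly_eq_zero hp
  refine ⟨m, ContinuousMap.toLp (E := ℂ) ∞ normMeas ℂ p + h, fun n hn => ?_, ?_⟩
  · have h1 : ⇑(ContinuousMap.toLp (E := ℂ) ∞ normMeas ℂ p + h) =ᵐ[normMeas] ⇑p + ⇑h := by
      filter_upwards [Lp.coeFn_add (ContinuousMap.toLp (E := ℂ) ∞ normMeas ℂ p) h,
        ContinuousMap.coeFn_toLp (𝕜 := ℂ) (p := ∞) normMeas p] with t h1 h2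
      rw [h1, Pi.add_apply, h2, Pi.add_apply]
    rw [fourierCoeff_congr_ae h1, fourierCoeff.add (integrable_continuousMap p)
      ((Lp.memLp h).integrable le_top), Pi.add_apply, hm n hn, hh n (by omega), add_zero]
  · rw [add_sub_add_right_eq_sub, ← map_sub]
    refine norm_Linfty_le_of_ae hη.le ?_
    filter_upwards [ContinuousMap.coeFn_toLp (𝕜 := ℂ) (p := ∞) normMeas (g - p)] with t ht
    rw [ht]
    exact ((g - p).norm_coe_le_norm t).trans hgp

namespace BanachFunctionNorm

variable {ρ : BanachFunctionNorm} {R : ρ.space →L[ℂ] ρ.space}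

theorem mulCLM_sub_apply (a b : Lp ℂ ∞ normMeas) (f : ρ.space) :
    ρ.mulCLM (a - b) f = ρ.mulCLM a f - ρ.mulCLM b f := by
  apply ext_ae
  filter_upwards [ρ.mulCLM_ae a f, ρ.mulCLM_ae b f, ρ.mulCLM_ae (a - b) f, Lp.coeFn_sub a b,
    coe_sub_ae (ρ.mulCLM a f) (ρ.mulCLM b f)] with t h1 h2 h3 h4 h5
  rw [h3, h5, h1, h2, h4, Pi.sub_apply, sub_mul]

theorem mulCLM_shift (a : Lp ℂ ∞ normMeas) (k : ℤ) (f : ρ.space) :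
    ρ.mulCLM a (ρ.shift k f) = ρ.shift k (ρ.mulCLM a f) := by
  apply ext_ae
  filter_upwards [ρ.mulCLM_ae a f, ρ.mulCLM_ae a (ρ.shift k f), ρ.shift_ae k f,
    ρ.shift_ae k (ρ.mulCLM a f)] with t h1 h2 h3 h4
  rw [h2, h3, h4, h1]; ring

theorem fourierCoeff_mulCLM_eq_zero {m : ℕ} {b : Lp ℂ ∞ normMeas} (hb : SpectrumBelow m b)
    {f : ρ.space} (hf : f ∈ ρ.hardy) {n : ℤ} (hn : n < -m) :
    fourierCoeff (ρ.mulCLM b f).1 n = 0 := by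
  have h := fourierCoeff_mul_eq_zero (h := fun t => fourier m t * b t) (f := f.1) (M := ‖b‖)
    (n := n + m) ((fourier m).continuous.aestronglyMeasurable.mul (Lp.aestronglyMeasurable b)) (by
      filter_upwards [ae_norm_le_norm_Linfty b] with t ht
      rwa [norm_mul, norm_fourier_apply, one_mul])
    (fun k hk => by rw [fourierCoeff_fourier_mul]; exact hb _ (by omega))
    (ρ.integrable_coe f) hf (by omega)
  simp only [mul_assoc] at h
  rw [fourierCoeff_fourier_mul, add_sub_cancel_right] at h
  rw [fourierCoeff_congr_ae (ρ.mulCLM_ae b f), h]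

/-- `P (a f)` is of Hardy class for all symbols in `C + H^∞`, by approximation of the symbol. -/
theorem IsRiesz.apply_mulCLM_mem (hR : ρ.IsRiesz R) {a : Lp ℂ ∞ normMeas} (ha : a ∈ cPlusHInfty)
    {f : ρ.space} (hf : f ∈ ρ.hardy) : R (ρ.mulCLM a f) ∈ ρ.hardy := by
  intro n hn
  obtain ⟨C, hC⟩ := ρ.exists_norm_fourierCoeff_le
  have hb : ∀ η > 0, ‖fourierCoeff (R (ρ.mulCLM a f)).1 n‖ ≤ |C| * (‖R‖ * (η * ‖f‖)) := by
    intro η hη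
    obtain ⟨m, b, hb, hab⟩ := exists_spectrumBelow_norm_sub_le ha hη
    have h1 : fourierCoeff (R (ρ.mulCLM b f)).1 n = 0 := by
      rw [hR.fourierCoeff_apply m _ (fun k hk => fourierCoeff_mulCLM_eq_zero hb hf hk),
        if_neg (by omega)]
    have h2 : fourierCoeff (R (ρ.mulCLM a f)).1 n = fourierCoeff (R (ρ.mulCLM (a - b) f)).1 n := by
      rw [mulCLM_sub_apply, map_sub, fourierCoeff_coe_sub, h1, sub_zero]
    rw [h2]
    refine (hC _ n).trans (mul_le_mul (le_abs_self C) ?_ (norm_nonneg _) (abs_nonneg C))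
    refine (R.le_opNorm _).trans (mul_le_mul_of_nonneg_left ?_ (norm_nonneg R))
    refine ((ρ.mulCLM (a - b)).le_opNorm f).trans (mul_le_mul_of_nonneg_right ?_ (norm_nonneg f))
    exact (ρ.norm_mulCLM_le _).trans hab
  have hlim : Tendsto (fun η : ℝ => |C| * (‖R‖ * (η * ‖f‖))) (𝓝[>] 0) (𝓝 0) := by
    have : ContinuousAt (fun η : ℝ => |C| * (‖R‖ * (η * ‖f‖))) 0 := by fun_prop
    have h2 := this.tendsto
    simp only [zero_mul, mul_zero] at h2
    exact h2.mono_left nhdsWithin_le_nhds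
  exact norm_le_zero_iff.1 (ge_of_tendsto hlim (by
    filter_upwards [self_mem_nhdsWithin] with η hη using hb η hη))

/-! ### Toeplitz operators -/

theorem IsRiesz.isToeplitz_iff (hR : ρ.IsRiesz R) {a : Lp ℂ ∞ normMeas}
    {A : ρ.hardy →L[ℂ] ρ.hardy} :
    IsToeplitz ρ a A ↔ ∀ f : ρ.hardy, (A f : ρ.space) = R (ρ.mulCLM a f) := by
  refine forall_congr' fun f => ⟨fun h => ?_, fun h => ?_⟩
  · exact (hR.eq_of (h.congr (ρ.mulCLM_ae a f).symm EventuallyEq.rfl)).symm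
  · rw [h]
    exact (hR _).congr (ρ.mulCLM_ae a f) EventuallyEq.rfl

theorem IsRiesz.isToeplitz_unique (hR : ρ.IsRiesz R) {a : Lp ℂ ∞ normMeas}
    {A B : ρ.hardy →L[ℂ] ρ.hardy} (hA : IsToeplitz ρ a A) (hB : IsToeplitz ρ a B) : A = B := by
  ext1 f
  exact Subtype.ext ((hR.isToeplitz_iff.1 hA f).trans (hR.isToeplitz_iff.1 hB f).symm)

theorem IsRiesz.exists_isToeplitz_of_mem (hR : ρ.IsRiesz R) {a : Lp ℂ ∞ normMeas}
    (h : ∀ f ∈ ρ.hardy, R (ρ.mulCLM a f) ∈ ρ.hardy) : ∃ A, IsToeplitz ρ a A :=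
  ⟨((R ∘L ρ.mulCLM a) ∘L ρ.hardy.subtypeL).codRestrict ρ.hardy fun f => h f.1 f.2,
    hR.isToeplitz_iff.2 fun _ => rfl⟩

theorem IsRiesz.exists_isToeplitz_of_spectrumBelow (hR : ρ.IsRiesz R) {m : ℕ}
    {b : Lp ℂ ∞ normMeas} (hb : SpectrumBelow m b) : ∃ A, IsToeplitz ρ b A :=
  hR.exists_isToeplitz_of_mem fun f hf n hn => by
    rw [hR.fourierCoeff_apply m _ (fun k hk => fourierCoeff_mulCLM_eq_zero hb hf hk),
      if_neg (by omega)]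

theorem IsRiesz.toeplitz_eq (hR : ρ.IsRiesz R) {a : Lp ℂ ∞ normMeas}
    {A : ρ.hardy →L[ℂ] ρ.hardy} (hA : IsToeplitz ρ a A) : toeplitz ρ a = A := by
  have h : ∃ A, IsToeplitz ρ a A := ⟨A, hA⟩
  rw [toeplitz, dif_pos h]
  exact hR.isToeplitz_unique h.choose_spec hA

theorem IsRiesz.norm_toeplitz_sub_le (hR : ρ.IsRiesz R) {a b : Lp ℂ ∞ normMeas}
    {A B : ρ.hardy →L[ℂ] ρ.hardy} (hA : IsToeplitz ρ a A) (hB : IsToeplitz ρ b B) :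
    ‖A - B‖ ≤ ‖R‖ * ‖a - b‖ := by
  refine ContinuousLinearMap.opNorm_le_bound _ (by positivity) fun f => ?_
  have h : ((A - B) f : ρ.space) = R (ρ.mulCLM (a - b) f) := by
    rw [mulCLM_sub_apply, map_sub, ← hR.isToeplitz_iff.1 hA f, ← hR.isToeplitz_iff.1 hB f]
    rfl
  rw [Submodule.coe_norm, h, mul_assoc]
  refine (R.le_opNorm _).trans (mul_le_mul_of_nonneg_left ?_ (norm_nonneg R))
  exact ((ρ.mulCLM (a - b)).le_opNorm _).trans
    (mul_le_mul_of_nonneg_right (ρ.norm_mulCLM_le _) (norm_nonneg _))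

/-- The upper bound: a symbol whose spectrum lies above `-m` is `z⁻ᵐ` times a symbol of Hardy
class, and its Toeplitz operator is the product of `m` backward shifts and a multiplication. -/
theorem IsRiesz.essNorm_le (hR : ρ.IsRiesz R) {S : ρ.hardy →L[ℂ] ρ.hardy}
    (hS : IsToeplitz ρ (fourierLp ∞ (-1)) S) (hS1 : essNorm S ≤ 1) (m : ℕ)
    {b : Lp ℂ ∞ normMeas} (hb : SpectrumBelow m b) {B : ρ.hardy →L[ℂ] ρ.hardy}
    (hB : IsToeplitz ρ b B) : essNorm B ≤ ‖b‖ := by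
  induction m generalizing b B with
  | zero =>
    refine (essNorm_le_norm B).trans (ContinuousLinearMap.opNorm_le_bound _ (norm_nonneg b) ?_)
    intro f
    have hm : ρ.mulCLM b f ∈ ρ.hardy := fun n hn =>
      fourierCoeff_mulCLM_eq_zero hb f.2 (by simpa using hn)
    rw [Submodule.coe_norm, hR.isToeplitz_iff.1 hB f, hR.apply_hardy hm]
    exact ((ρ.mulCLM b).le_opNorm _).trans
      (mul_le_mul_of_nonneg_right (ρ.norm_mulCLM_le _) (norm_nonneg _))
  | succ m ih =>
    obtain ⟨b', hb', hbn, hbb⟩ := exists_shift_symbol hb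
    obtain ⟨B', hB'⟩ := hR.exists_isToeplitz_of_spectrumBelow hb'
    have hcomp : B = S ∘L B' := by
      refine hR.isToeplitz_unique hB (hR.isToeplitz_iff.2 fun f => ?_)
      set F := ρ.mulCLM b' f with hF
      have hFs : ∀ n : ℤ, n < -m → fourierCoeff F.1 n = 0 := fun n hn =>
        fourierCoeff_mulCLM_eq_zero hb' f.2 hn
      have hbF : ρ.mulCLM b f = ρ.shift (-1) F := by
        apply ext_ae
        filter_upwards [ρ.mulCLM_ae b f, ρ.shift_ae (-1) F, ρ.mulCLM_ae b' f, hbb]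
          with t h1 h2 h3 h4
        rw [h1, h2, hF, h3, h4, ← mul_assoc, ← mul_assoc, ← fourier_add, neg_add_cancel,
          fourier_zero, one_mul]
      have hRF : R F ∈ ρ.hardy := by
        rw [hF, ← hR.isToeplitz_iff.1 hB' f]; exact (B' f).2
      rw [ContinuousLinearMap.comp_apply, hR.isToeplitz_iff.1 hS, hR.isToeplitz_iff.1 hB' f, hbF,
        hR.apply_shift F]
      refine (hR.apply_shift (R F)).trans ?_
      rw [hR.apply_hardy hRF, hR.fourierCoeff_apply m F hFs, if_pos le_rfl]
    rw [hcomp]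
    calc _ ≤ essNorm S * essNorm B' := essNorm_comp_le _ _
      _ ≤ 1 * ‖b'‖ := mul_le_mul hS1 (ih hb' hB') (essNorm_nonneg _) zero_le_one
      _ ≤ ‖b‖ := by rwa [one_mul]

/-- A compact perturbation does not lower the norm of a Toeplitz operator below the norm of the
multiplication operator on trigonometric polynomials: multiplied by high powers of `z` these
belong to the Hardy space, where the operator multiplies them by the symbol, and a subsequence of
their images under the compact operator converges, to zero because its averages do. -/
theorem IsRiesz.norm_mulCLM_trigPoly_le (hR : ρ.IsRiesz R) {m : ℕ} {b : Lp ℂ ∞ normMeas}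
    (hb : SpectrumBelow m b) {B K : ρ.hardy →L[ℂ] ρ.hardy} (hB : IsToeplitz ρ b B)
    (hK : IsCompactOperator K) {p : C(UnitCirc, ℂ)} (hp : p ∈ trigPoly) {P : ρ.space}
    (hP : P.1 =ᵐ[normMeas] p) : ‖ρ.mulCLM b P‖ ≤ ‖B - K‖ * ‖P‖ := by
  obtain ⟨k, hk⟩ := fourierCoeff_trigPoly_eq_zero hp
  rw [← fourierCoeff_congr_ae hP] at hk
  set v := ρ.shift ((m : ℤ) + k) P with hv
  have hvb : ∀ᵐ t ∂normMeas, ‖v.1 t‖ ≤ ‖p‖ := by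
    filter_upwards [ρ.shift_ae ((m : ℤ) + k) P, hP] with t h1 h2
    rw [h1, norm_mul, norm_fourier_apply, one_mul, h2]
    exact p.norm_coe_le_norm t
  have hmem : ∀ n : ℕ, ρ.shift n v ∈ ρ.hardy := fun n l hl => by
    rw [fourierCoeff_shift, hv, fourierCoeff_shift]
    exact hk _ (by omega)
  set V : ℕ → ρ.hardy := fun n => ⟨ρ.shift n v, hmem n⟩ with hV
  have hVn : ∀ n, ‖V n‖ = ‖P‖ := fun n => by
    rw [Submodule.coe_norm]
    exact (ρ.norm_shift _ _).trans (ρ.norm_shift _ _)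
  have hBV : ∀ n, ‖B (V n)‖ = ‖ρ.mulCLM b P‖ := by
    intro n
    have hbv : ρ.mulCLM b (V n) = ρ.shift ((n : ℤ) + ((m : ℤ) + k)) (ρ.mulCLM b P) := by
      rw [← mulCLM_shift, ← shift_shift]
    have hPk : ρ.shift k P ∈ ρ.hardy := fun l hl => by
      rw [fourierCoeff_shift]; exact hk _ (by omega)
    have hbvm : ρ.mulCLM b (V n) ∈ ρ.hardy := fun l hl => by
      have h1 : ρ.mulCLM b P = ρ.shift (-k) (ρ.mulCLM b (ρ.shift k P)) := by
        rw [mulCLM_shift, shift_shift, neg_add_cancel, shift_zero]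
      rw [hbv, h1, fourierCoeff_shift, fourierCoeff_shift]
      exact fourierCoeff_mulCLM_eq_zero hb hPk (by omega)
    rw [Submodule.coe_norm, hR.isToeplitz_iff.1 hB, hR.apply_hardy hbvm, hbv, norm_shift]
  obtain ⟨g, -, φ, hφ, hg⟩ := (hK.isCompact_closure_image_closedBall
    (f := (K : ρ.hardy →ₗ[ℂ] ρ.hardy)) ‖P‖).tendsto_subseq (x := fun n => K (V n)) fun n =>
      subset_closure ⟨V n, by rw [mem_closedBall_zero_iff, hVn], rfl⟩
  have hav : Tendsto (fun N : ℕ => (N : ℂ)⁻¹ • ∑ i ∈ Finset.range N, V (φ i)) atTop (𝓝 0) := by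
    rw [tendsto_subtype_rng]
    refine (hR.tendsto_average_shift hφ hvb).congr fun N => ?_
    rw [Submodule.coe_smul, Submodule.coe_sum]
  have hKav := (K.continuous.tendsto 0).comp hav
  rw [map_zero] at hKav
  have hces := hg.cesaro_smul
  have hg0 : g = 0 := by
    refine tendsto_nhds_unique hces (hKav.congr fun N => ?_)
    rw [Function.comp_apply, map_smul, map_sum, ← Complex.coe_smul]
    push_cast
    rfl
  rw [hg0] at hg
  have hlim : Tendsto (fun n => ‖B - K‖ * ‖P‖ + ‖K (V (φ n))‖) atTop
      (𝓝 (‖B - K‖ * ‖P‖ + ‖(0 : ρ.hardy)‖)) :=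
    hg.norm.const_add _
  rw [norm_zero, add_zero] at hlim
  refine ge_of_tendsto' hlim fun n => ?_
  rw [← hBV (φ n), ← hVn (φ n)]
  have h1 : B (V (φ n)) = (B - K) (V (φ n)) + K (V (φ n)) := by simp
  rw [h1]
  exact (norm_add_le _ _).trans (add_le_add ((B - K).le_opNorm _) le_rfl)

/-- The essential norm is at least the norm of the symbol: compare `b χ` and `χ` for the indicator
function `χ` of a set where `|b|` is nearly maximal, approximating `χ` by trigonometric polynomials
in the norm of the space. -/
theorem IsRiesz.le_essNorm (hR : ρ.IsRiesz R) {m : ℕ} {b : Lp ℂ ∞ normMeas}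
    (hb : SpectrumBelow m b) {B : ρ.hardy →L[ℂ] ρ.hardy} (hB : IsToeplitz ρ b B) :
    ‖b‖ ≤ essNorm B := by
  refine AbstractHardy.le_essNorm fun K hK => ?_
  refine le_of_forall_lt_imp_le_of_dense fun c hcb => ?_
  rcases lt_or_ge c 0 with hc | hc
  · exact hc.le.trans (norm_nonneg _)
  -- test functions concentrated on the set where the symbol is large
  set s : Set UnitCirc := {t | c < ‖b t‖} with hs
  have hsm : MeasurableSet s :=
    measurableSet_lt measurable_const (Lp.stronglyMeasurable b).measurable.norm
  set ψ : UnitCirc → ℝ := s.indicator fun _ => 1 with hψ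
  have hψm : AEStronglyMeasurable ψ normMeas :=
    (measurable_const.indicator hsm).aestronglyMeasurable
  have h01 : ∀ t, 0 ≤ ψ t ∧ ψ t ≤ 1 := fun t => by
    rw [hψ, Set.indicator_apply]; split_ifs <;> simp
  obtain ⟨χ, hχ⟩ := ρ.exists_of_bounded (φ := fun t => (ψ t : ℂ)) (M := 1)
    (Complex.continuous_ofReal.comp_aestronglyMeasurable hψm) (ae_of_all _ fun t => by
      rw [Complex.norm_real, Real.norm_of_nonneg (h01 t).1]; exact (h01 t).2)
  have hχ0 : 0 < ‖χ‖ := by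
    rw [norm_pos_iff]
    intro h0
    have h2 : ∀ᵐ t ∂normMeas, ‖b t‖ ≤ c := by
      filter_upwards [hχ, AEEqFun.coeFn_zero (α := UnitCirc) (β := ℂ) (μ := normMeas)]
        with t h1 h2
      rw [h0] at h1
      by_contra h3
      have h4 : ψ t = 1 := Set.indicator_of_mem (s := s) (by simpa [hs] using h3) _
      rw [h4] at h1
      have h5 : ((0 : ρ.space).1 : UnitCirc → ℂ) t = 0 := h2
      rw [h5] at h1
      simp at h1
    exact absurd (norm_Linfty_le_of_ae hc h2) (not_le.2 hcb)
  have hlow : c * ‖χ‖ ≤ ‖ρ.mulCLM b χ‖ := by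
    have h1 : ‖(c : ℂ) • χ‖ ≤ 1 * ‖ρ.mulCLM b χ‖ := by
      refine norm_le_mul zero_le_one ?_
      filter_upwards [hχ, ρ.mulCLM_ae b χ, coe_smul_ae (c : ℂ) χ] with t h1 h2 h3
      rw [h3, h2, h1, one_mul, norm_mul, norm_mul, Complex.norm_real, Real.norm_of_nonneg hc]
      by_cases ht : t ∈ s
      · exact mul_le_mul_of_nonneg_right (le_of_lt ht) (norm_nonneg _)
      · have : ψ t = 0 := Set.indicator_of_notMem ht _
        simp [this]
    rwa [norm_smul, Complex.norm_real, Real.norm_of_nonneg hc, one_mul] at h1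
  have hη : ∀ η > 0, c * ‖χ‖ ≤ ‖B - K‖ * (‖χ‖ + η) + ‖b‖ * η := by
    intro η hη
    obtain ⟨p, hp, P, hP, hχP⟩ :=
      hR.exists_trigPoly_norm_sub_le hψm (ae_of_all _ h01) hχ hη
    have h1 := hR.norm_mulCLM_trigPoly_le hb hB hK hp hP
    have h2 : ρ.mulCLM b χ = ρ.mulCLM b P + ρ.mulCLM b (χ - P) := by rw [map_sub]; abel
    have h3 : ‖ρ.mulCLM b (χ - P)‖ ≤ ‖b‖ * η :=
      ((ρ.mulCLM b).le_opNorm _).trans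
        (mul_le_mul (ρ.norm_mulCLM_le b) hχP (norm_nonneg _) (norm_nonneg _))
    have h4 : ‖P‖ ≤ ‖χ‖ + η := by
      have : P = χ - (χ - P) := by abel
      rw [this]
      exact (norm_sub_le _ _).trans (add_le_add le_rfl hχP)
    calc c * ‖χ‖ ≤ ‖ρ.mulCLM b χ‖ := hlow
      _ ≤ ‖ρ.mulCLM b P‖ + ‖ρ.mulCLM b (χ - P)‖ := by rw [h2]; exact norm_add_le _ _
      _ ≤ ‖B - K‖ * (‖χ‖ + η) + ‖b‖ * η :=
          add_le_add (h1.trans (mul_le_mul_of_nonneg_left h4 (ContinuousLinearMap.opNorm_nonneg _)))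
            h3
  have hlim : Tendsto (fun η : ℝ => ‖B - K‖ * (‖χ‖ + η) + ‖b‖ * η) (𝓝[>] 0)
      (𝓝 (‖B - K‖ * ‖χ‖)) := by
    have : ContinuousAt (fun η : ℝ => ‖B - K‖ * (‖χ‖ + η) + ‖b‖ * η) 0 := by fun_prop
    have h2 := this.tendsto
    simp only [add_zero, mul_zero] at h2
    exact h2.mono_left nhdsWithin_le_nhds
  refine le_of_mul_le_mul_right (ge_of_tendsto hlim ?_) hχ0
  filter_upwards [self_mem_nhdsWithin] with η h using hη η h

theorem IsRiesz.essNorm_eq (hR : ρ.IsRiesz R) {S : ρ.hardy →L[ℂ] ρ.hardy}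
    (hS : IsToeplitz ρ (fourierLp ∞ (-1)) S) (hS1 : essNorm S ≤ 1) {a : Lp ℂ ∞ normMeas}
    (ha : a ∈ cPlusHInfty) {A : ρ.hardy →L[ℂ] ρ.hardy} (hA : IsToeplitz ρ a A) :
    essNorm A = ‖a‖ := by
  have key : ∀ η > 0, |essNorm A - ‖a‖| ≤ (‖R‖ + 1) * η := by
    intro η hη
    obtain ⟨m, b, hb, hab⟩ := exists_spectrumBelow_norm_sub_le ha hη
    obtain ⟨B, hB⟩ := hR.exists_isToeplitz_of_spectrumBelow hb
    have h1 := hR.essNorm_le hS hS1 m hb hB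
    have h2 := hR.le_essNorm hb hB
    have h3 := essNorm_le_add_norm_sub A B
    have h4 := essNorm_le_add_norm_sub B A
    have h5 : ‖A - B‖ ≤ ‖R‖ * η := (hR.norm_toeplitz_sub_le hA hB).trans
      (mul_le_mul_of_nonneg_left hab (norm_nonneg R))
    rw [norm_sub_rev] at h4
    have h6 := abs_le.1 ((abs_norm_sub_norm_le a b).trans hab)
    rw [abs_le]
    constructor <;> linarith [h6.1, h6.2]
  have hlim : Tendsto (fun η : ℝ => (‖R‖ + 1) * η) (𝓝[>] 0) (𝓝 0) := by
    have : ContinuousAt (fun η : ℝ => (‖R‖ + 1) * η) 0 := by fun_prop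
    have h2 := this.tendsto
    simp only [mul_zero] at h2
    exact h2.mono_left nhdsWithin_le_nhds
  have h0 := ge_of_tendsto hlim (by
    filter_upwards [self_mem_nhdsWithin] with η hη using key η hη)
  exact sub_eq_zero.1 (abs_nonpos_iff.1 h0)

end BanachFunctionNorm

theorem fourierLp_mem_cPlusHInfty (n : ℤ) : fourierLp ∞ n ∈ cPlusHInfty := by
  refine ⟨fourier n, 0, fun k _ => ?_, by rw [add_zero]⟩
  rw [fourierCoeff_congr_ae (Lp.coeFn_zero ℂ ∞ normMeas)]
  simp [fourierCoeff]

theorem norm_fourierLp_top (n : ℤ) : ‖(fourierLp ∞ n : Lp ℂ ∞ normMeas)‖ = 1 := by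
  have hae := coeFn_fourierLp (T := 2 * Real.pi) ∞ n
  apply le_antisymm
  · refine norm_Linfty_le_of_ae zero_le_one ?_
    filter_upwards [hae] with t ht
    rw [ht, norm_fourier_apply]
  · obtain ⟨t, h1, h2⟩ := (hae.and (ae_norm_le_norm_Linfty (fourierLp ∞ n))).exists
    rwa [h1, norm_fourier_apply] at h2

end AbstractHardy

end

theorem theorem1p2 (ρ : AbstractHardy.BanachFunctionNorm)
    (hP : AbstractHardy.RieszProjectionBounded ρ) :
    (∀ a ∈ AbstractHardy.cPlusHInfty,
      ∃! A : ρ.hardy →L[ℂ] ρ.hardy, AbstractHardy.IsToeplitz ρ a A) ∧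
    (AbstractHardy.essNorm (AbstractHardy.toeplitz ρ (fourierLp ∞ (-1))) = 1 ↔
      ∀ a ∈ AbstractHardy.cPlusHInfty,
        AbstractHardy.essNorm (AbstractHardy.toeplitz ρ a) = ‖a‖) := by
  obtain ⟨R, hR⟩ := ρ.exists_isRiesz hP
  have hex : ∀ a ∈ AbstractHardy.cPlusHInfty, ∃ A, AbstractHardy.IsToeplitz ρ a A := fun a ha =>
    hR.exists_isToeplitz_of_mem fun f hf => hR.apply_mulCLM_mem ha hf
  refine ⟨fun a ha => ?_, fun h a ha => ?_, fun h => ?_⟩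
  · obtain ⟨A, hA⟩ := hex a ha
    exact ⟨A, hA, fun B hB => hR.isToeplitz_unique hB hA⟩
  · obtain ⟨S, hS⟩ := hex _ (AbstractHardy.fourierLp_mem_cPlusHInfty (-1))
    obtain ⟨A, hA⟩ := hex a ha
    rw [hR.toeplitz_eq hS] at h
    rw [hR.toeplitz_eq hA]
    exact hR.essNorm_eq hS h.le ha hA
  · rw [h _ (AbstractHardy.fourierLp_mem_cPlusHInfty (-1)), AbstractHardy.norm_fourierLp_top]
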